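/- Let $r_0>0$ and $\bar a>\bar b$ be real numbers with $64r_0(2\bar a+\bar b)=1$, and put $p=-q=r_0^3$. Let $(a,b)$ be the corresponding member of the $\mathbb{B}_7$-family of ALC $G_2$-metrics on $S^3\times\mathbb{R}^4$. That is, $a,b:[0,\infty)\to\mathbb{R}$ are smooth functions with $$a(t)=r_0^3+\tfrac14 r_0t^2+\bar a t^4+O(t^6),\qquad b(t)=r_0^3+\tfrac14 r_0t^2+\bar b t^4+O(t^6)\qquad (t\to0),$$ which for all $t>0$ are non-degenerate ($F(a,b)>0$ and $x_1^2x_2>0$) and solve the Hitchin flow equations $$\dot x_1=\frac{\partial_aF(y_1,y_2)}{4\sqrt{F(y_1,y_2)}},\quad \dot x_2=\frac{\partial_bF(y_1,y_2)}{2\sqrt{F(y_1,y_2)}},\quad \dot y_1=\frac{x_1x_2}{\sqrt{x_1^2x_2}},\quad \dot y_2=\frac{x_1^2}{\sqrt{x_1^2x_2}},$$ where $x_1=\dot a\dot b$, $x_2=\dot a^2$, $y_1=a$, $y_2=b$ and $F(a,b)=4a^2(b-p)(b+q)-(b^2+pq)^2$. Let $\ell=\lim_{t\to\infty}\bigl(\tfrac{2b^3}{3a^2}\bigr)^{1/3}$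 be the asymptotic length of the circle fibre, and let $$A_1=\sqrt{\tfrac{(b-p)(2a-b-p)}{\dot a\dot b}},\quad B_1=\sqrt{\tfrac{(b-p)(2a+b+p)}{\dot a\dot b}},\quad A_3=\tfrac{b-p}{\dot a},\quad B_3=\tfrac{2\dot a\dot b}{b-p}$$ be the metric coefficients. Consider, for real functions $f^+,g^+$ of $t$, the reduced $G_2$-instanton equations $$\dot f^++\tfrac12\Bigl(\tfrac{A_1^2+B_3^2+B_1^2}{A_1B_1B_3}-\tfrac{A_3^2+2A_1^2}{A_1^2A_3}\Bigr)f^+=-f^+g^+,\qquad \dot g^++\tfrac12\Bigl(\tfrac{A_3}{B_1^2}-\tfrac{A_3}{A_1^2}\Bigr)g^+=-(f^+)^2.\qquad(*)$$ Then $\ell>0$, and for every $(G_\infty,\lambda)\in[\ell^{-1},\infty)\times\mathbb{R}$ there are a number $T=T(G_\infty,\lambda)>0$ and a smooth solution $(f^+,g^+)=(f^+_{G_\infty,\lambda},g^+_{G_\infty,\lambda})$ of $(*)$ on $(T,\infty)$ such that, as $t\to\infty$, $$g^+(t)\to G_\infty,\qquad f^+(t)=e^{(\ell^{-1}-G_\infty)t}\bigl[\lambda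 t^{-5/2}+O(t^{-7/2})\bigr].$$ The solution is determined by $(G_\infty,\lambda)$: any solution of $(*)$ on some $(T',\infty)$ with these two properties coincides with it on $(\max(T,T'),\infty)$. The solutions can be chosen so that they depend continuously on $(G_\infty,\lambda)$, uniformly on compact intervals of $t$: for every $P_0\in[\ell^{-1},\infty)\times\mathbb{R}$ and every compact interval $[t_1,t_2]\subset(T(P_0),\infty)$, one has $T(P)<t_1$ for all $P\in[\ell^{-1},\infty)\times\mathbb{R}$ close enough to $P_0$, and $f^+_P\to f^+_{P_0}$, $g^+_P\to g^+_{P_0}$ uniformly on $[t_1,t_2]$ as $P\to P_0$ in $[\ell^{-1},\infty)\times\mathbb{R}$. -/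

import Mathlib

open Filter Topology Set Asymptotics
open scoped ContDiff

noncomputable section

namespace G2End

/-- The potential `F(a, b) = 4 a² (b - p) (b + q) - (b² + p q)²`. -/
def potential (p q a b : ℝ) : ℝ :=
  4 * a ^ 2 * (b - p) * (b + q) - (b ^ 2 + p * q) ^ 2

/-- `(a, b)` solves the Hitchin flow equations on `(0, ∞)` with constants `p`, `q`, in terms of
`x₁ = a' b'`, `x₂ = (a')²`, `y₁ = a`, `y₂ = b`. The first two fields say that the square roots and
the quotients on the right-hand sides are meaningful (the 3-form is non-degenerate). -/
structure IsHitchinFlow (p q : ℝ) (a b : ℝ → ℝ) : Prop where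
  potential_pos : ∀ t, 0 < t → 0 < potential p q (a t) (b t)
  volume_pos : ∀ t, 0 < t → 0 < (deriv a t * deriv b t) ^ 2 * (deriv a t) ^ 2
  hasDerivAt_x₁ : ∀ t, 0 < t →
    HasDerivAt (fun s => deriv a s * deriv b s)
      (deriv (fun y => potential p q y (b t)) (a t) / (4 * √(potential p q (a t) (b t)))) t
  hasDerivAt_x₂ : ∀ t, 0 < t →
    HasDerivAt (fun s => (deriv a s) ^ 2)
      (deriv (fun y => potential p q (a t) y) (b t) / (2 * √(potential p q (a t) (b t)))) t
  hasDerivAt_y₁ : ∀ t, 0 < t →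
    HasDerivAt a ((deriv a t * deriv b t) * (deriv a t) ^ 2 /
      √((deriv a t * deriv b t) ^ 2 * (deriv a t) ^ 2)) t
  hasDerivAt_y₂ : ∀ t, 0 < t →
    HasDerivAt b ((deriv a t * deriv b t) ^ 2 /
      √((deriv a t * deriv b t) ^ 2 * (deriv a t) ^ 2)) t

/-- `(a, b)` is the member with parameters `r₀ > 0`, `abar`, `bbar` of the `𝔹₇`-family of complete
ALC `G₂`-metrics on `S³ × ℝ⁴`: a solution of the Hitchin flow for all positive times with
`p = -q = r₀³`, smooth up to `t = 0`, with the prescribed expansion at the singular orbit. -/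
structure IsB7Member (r₀ abar bbar : ℝ) (a b : ℝ → ℝ) : Prop where
  r₀_pos : 0 < r₀
  constraint : 64 * r₀ * (2 * abar + bbar) = 1
  bbar_lt_abar : bbar < abar
  contDiffOn_a : ContDiffOn ℝ ∞ a (Ici 0)
  contDiffOn_b : ContDiffOn ℝ ∞ b (Ici 0)
  expansion_a : (fun t => a t - (r₀ ^ 3 + r₀ / 4 * t ^ 2 + abar * t ^ 4)) =O[𝓝[>] 0]
    fun t => t ^ 6
  expansion_b : (fun t => b t - (r₀ ^ 3 + r₀ / 4 * t ^ 2 + bbar * t ^ 4)) =O[𝓝[>] 0]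
    fun t => t ^ 6
  flow : IsHitchinFlow (r₀ ^ 3) (-r₀ ^ 3) a b

/-- `ℓ` is the asymptotic length `lim (2 b³ / (3 a²))^{1/3}` of the circle fibre. -/
def IsAsymptoticCircleLength (a b : ℝ → ℝ) (ℓ : ℝ) : Prop :=
  Tendsto (fun t => (2 * b t ^ 3 / (3 * a t ^ 2)) ^ (1 / 3 : ℝ)) atTop (𝓝 ℓ)

/-! The metric coefficients `A₁ = A₂`, `B₁ = B₂`, `A₃`, `B₃`. -/

/-- The metric coefficient `A₁`. -/
def coeffA₁ (p : ℝ) (a b : ℝ → ℝ) (t : ℝ) : ℝ :=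
  √((b t - p) * (2 * a t - b t - p) / (deriv a t * deriv b t))

/-- The metric coefficient `B₁`. -/
def coeffB₁ (p : ℝ) (a b : ℝ → ℝ) (t : ℝ) : ℝ :=
  √((b t - p) * (2 * a t + b t + p) / (deriv a t * deriv b t))

/-- The metric coefficient `A₃`. -/
def coeffA₃ (p : ℝ) (a b : ℝ → ℝ) (t : ℝ) : ℝ :=
  (b t - p) / deriv a t

/-- The metric coefficient `B₃`. -/
def coeffB₃ (p : ℝ) (a b : ℝ → ℝ) (t : ℝ) : ℝ :=
  2 * deriv a t * deriv b t / (b t - p)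

/-- The reduced instanton equations at time `t` for metric coefficients `A₁, B₁, A₃, B₃`:
`f' + ½ ((A₁² + B₃² + B₁²)/(A₁ B₁ B₃) - (A₃² + 2 A₁²)/(A₁² A₃)) f = - f g`,
`g' + ½ (A₃/B₁² - A₃/A₁²) g = - f²`. -/
def ReducedODEAt (A₁ B₁ A₃ B₃ f g : ℝ → ℝ) (t : ℝ) : Prop :=
  DifferentiableAt ℝ f t ∧ DifferentiableAt ℝ g t ∧
  deriv f t + 1 / 2 * ((A₁ t ^ 2 + B₃ t ^ 2 + B₁ t ^ 2) / (A₁ t * B₁ t * B₃ t)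
      - (A₃ t ^ 2 + 2 * A₁ t ^ 2) / (A₁ t ^ 2 * A₃ t)) * f t = -(f t * g t) ∧
  deriv g t + 1 / 2 * (A₃ t / B₁ t ^ 2 - A₃ t / A₁ t ^ 2) * g t = -(f t) ^ 2

/-- `(f, g)` solves the reduced instanton equations on `(T, ∞)` over the metric determined by
`(a, b)` and `p`. -/
def IsReducedSolution (p : ℝ) (a b : ℝ → ℝ) (T : ℝ) (f g : ℝ → ℝ) : Prop :=
  ∀ t, T < t →
    ReducedODEAt (coeffA₁ p a b) (coeffB₁ p a b) (coeffA₃ p a b) (coeffB₃ p a b) f g t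

/-- The end behaviour with parameters `(G, lam)`: `g → G` and
`f = e^{(ℓ⁻¹ - G) t} (lam t^{-5/2} + O(t^{-7/2}))` as `t → ∞`. -/
def HasEndBehaviour (ℓ G lam : ℝ) (f g : ℝ → ℝ) : Prop :=
  Tendsto g atTop (𝓝 G) ∧
  (fun t => f t - Real.exp ((ℓ⁻¹ - G) * t) * (lam * t ^ (-(5 / 2) : ℝ))) =O[atTop]
    fun t => Real.exp ((ℓ⁻¹ - G) * t) * t ^ (-(7 / 2) : ℝ)

/-- The parameter space `[ℓ⁻¹, ∞) × ℝ`. -/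
def endParameters (ℓ : ℝ) : Set (ℝ × ℝ) :=
  Ici ℓ⁻¹ ×ˢ univ

end G2End

end

/-!
The metric enters the reduced equations only through two coefficients, so that they read
`f' = -(φ + g) f`, `g' = -ψ g - f²` (`ReducedFlow.reducedODEAt_iff`). The proof has two independent
halves: the coefficients satisfy `φ = -ℓ⁻¹ + 5 / (2 t) + O(t⁻²)` and `ψ = O(t⁻³)`, and any system
with such coefficients has the asserted family of solutions.

*The coefficients.* Write `p = r₀³`, `u = a'` and `D = √(4 a² - (b + p)²)`. The Hamiltonian of the
flow is conserved and vanishes at the singular orbit, which gives `2 u² b' = (b - p) D` and turns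
the flow into a first order system for `(a, b, u)` (`IsB7Member.reducedFlow`). The condition
`bbar < abar` makes `a - b` positive near the singular orbit, and `(u (a - b)')'` is a positive
multiple of `a - b`, so `b < a` for all times. Since the circle length has a finite limit, `b` is
`O(a^{2/3})`; comparing the derivatives of `u³` and `(3/2) a²` then gives
`u³ = (3/2) a² (1 + O(t⁻²))`, whence `a ∼ t³ / 18` and `a / u = t / 3 + O(1)`. The coefficient
`A₃ = (b - p) / u` is positive and increasing with derivative `O(t⁻³)`, and its limit is `ℓ`;
therefore `ℓ > 0` and `A₃ = ℓ + O(t⁻²)`. Inserting these rates into the coefficients gives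
`EndGrowth.fCoeff_isBigO` and `EndGrowth.gCoeff_isBigO`.

*The solutions.* Put `φ = -ℓ⁻¹ + 5 / (2 t) + σ` and `h = g - G`. The equation for `f` is linear, so
`f = e^{(ℓ⁻¹ - G) t} t^{-5/2} lam exp (∫_t^∞ (σ + h))`, and the equation for `g` becomes a fixed
point equation for `h` alone, whose right-hand side contracts functions of size `M / t²` on
`[T, ∞)` once `T` is large; `G ≥ ℓ⁻¹` is what bounds the exponential weight. The same contraction
estimate shows that the fixed point is unique and depends Lipschitz continuously on `(G, lam)`
(`IsProfile.abs_sub_le`). The time `T` is an explicit continuous function of `(G, lam)`, so no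
continuation of solutions is needed for the continuous dependence. Conversely, any solution with
the prescribed end behaviour has `h = O(t⁻²)` and satisfies the fixed point equation near infinity
(`exists_isProfile_of_hasEndBehaviour`); uniqueness for the Cauchy problem propagates the agreement
to earlier times.
-/

namespace G2End
open MeasureTheory

/-! ### Tail integrals -/

/-- The tail integral `∫_t^∞ u`. -/
noncomputable def tail (u : ℝ → ℝ) (t : ℝ) : ℝ := ∫ s in Ioi t, u s

/-- `u` is continuous on `[T, ∞)` and bounded there by `C / s ^ (n + 2)`; in particular it is
integrable at infinity, and its tail integral is `O(t ^ (-(n + 1)))`. -/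
structure Decays (u : ℝ → ℝ) (T C : ℝ) (n : ℕ) : Prop where
  pos : 0 < T
  cont : ContinuousOn u (Ici T)
  bound : ∀ s, T ≤ s → |u s| ≤ C / s ^ (n + 2)

lemma rpow_neg_eq_one_div_pow (n : ℕ) {s : ℝ} (hs : 0 < s) :
    s ^ (-((n : ℝ) + 2)) = 1 / s ^ (n + 2) := by
  rw [Real.rpow_neg hs.le, one_div]
  congr 1
  exact_mod_cast Real.rpow_natCast s (n + 2)

lemma integrableOn_const_div_pow (C : ℝ) (n : ℕ) {t : ℝ} (ht : 0 < t) :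
    IntegrableOn (fun s : ℝ => C / s ^ (n + 2)) (Ioi t) := by
  have h : IntegrableOn (fun s : ℝ => C * s ^ (-((n : ℝ) + 2))) (Ioi t) :=
    (integrableOn_Ioi_rpow_of_lt (by have := n.cast_nonneg (α := ℝ); linarith) ht).const_mul C
  refine h.congr_fun (fun s hs => ?_) measurableSet_Ioi
  simp only [rpow_neg_eq_one_div_pow n (ht.trans hs)]
  ring

lemma integral_const_div_pow (C : ℝ) (n : ℕ) {t : ℝ} (ht : 0 < t) :
    ∫ s in Ioi t, C / s ^ (n + 2) = C / ((n + 1) * t ^ (n + 1)) := by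
  have h : ∫ s in Ioi t, C / s ^ (n + 2) = ∫ s in Ioi t, C * s ^ (-((n : ℝ) + 2)) := by
    refine setIntegral_congr_fun measurableSet_Ioi (fun s hs => ?_)
    simp only [rpow_neg_eq_one_div_pow n (ht.trans hs)]
    ring
  have hn : (0 : ℝ) < n + 1 := by positivity
  have h2 : t ^ (-((n : ℝ) + 2) + 1) = 1 / t ^ (n + 1) := by
    rw [show -((n : ℝ) + 2) + 1 = -((n : ℝ) + 1) by ring, Real.rpow_neg ht.le, one_div]
    congr 1
    exact_mod_cast Real.rpow_natCast t (n + 1)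
  rw [h, integral_const_mul, integral_Ioi_rpow_of_lt (by linarith) ht, h2,
    show -((n : ℝ) + 2) + 1 = -((n : ℝ) + 1) by ring]
  field_simp

namespace Decays

variable {u v : ℝ → ℝ} {T C C' : ℝ} {n : ℕ}

lemma mono (h : Decays u T C n) {T' : ℝ} (hT : T ≤ T') (hC : C ≤ C') : Decays u T' C' n where
  pos := h.pos.trans_le hT
  cont := h.cont.mono (Ici_subset_Ici.2 hT)
  bound s hs := by
    have hs0 : 0 < s := h.pos.trans_le (hT.trans hs)
    exact (h.bound s (hT.trans hs)).trans (by gcongr)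

lemma integrableOn (h : Decays u T C n) : IntegrableOn u (Ioi T) := by
  refine (integrableOn_const_div_pow C n h.pos).mono'
    ((h.cont.mono Ioi_subset_Ici_self).aestronglyMeasurable measurableSet_Ioi) ?_
  filter_upwards [ae_restrict_mem measurableSet_Ioi] with s hs
  exact h.bound s (le_of_lt hs)

lemma integrableOn_Ioi (h : Decays u T C n) {t : ℝ} (ht : T ≤ t) : IntegrableOn u (Ioi t) :=
  h.integrableOn.mono_set (Ioi_subset_Ioi ht)

lemma abs_tail_le (h : Decays u T C n) {t : ℝ} (ht : T ≤ t) :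
    |tail u t| ≤ C / ((n + 1) * t ^ (n + 1)) := by
  have ht0 := h.pos.trans_le ht
  rw [← integral_const_div_pow C n ht0, tail, ← Real.norm_eq_abs]
  refine norm_integral_le_of_norm_le (integrableOn_const_div_pow C n ht0) ?_
  filter_upwards [ae_restrict_mem measurableSet_Ioi] with s hs
  exact h.bound s (ht.trans (le_of_lt hs))

lemma abs_sq_mul_tail_le (h : Decays u T C 1) {t : ℝ} (ht : T ≤ t) :
    |t ^ 2 * tail u t| ≤ C / 2 := by
  have ht0 := h.pos.trans_le ht
  rw [abs_mul, abs_of_pos (by positivity : 0 < t ^ 2)]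
  calc _ ≤ t ^ 2 * (C / (((1 : ℕ) + 1) * t ^ (1 + 1))) := by gcongr; exact h.abs_tail_le ht
    _ = C / 2 := by push_cast; field_simp; norm_num

lemma tail_eq (h : Decays u T C n) {t : ℝ} (ht : T ≤ t) :
    tail u t = tail u T - ∫ s in T..t, u s := by
  have := intervalIntegral.integral_Ioi_sub_Ioi h.integrableOn ht
  simp only [tail]
  linarith

lemma hasDerivAt_tail (h : Decays u T C n) {t : ℝ} (ht : T < t) :
    HasDerivAt (tail u) (-u t) t := by
  have hI : IntervalIntegrable u volume T t :=
    (h.cont.mono (by rw [uIcc_of_le ht.le]; exact Icc_subset_Ici_self)).intervalIntegrable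
  have h1 : HasDerivAt (fun x => ∫ s in T..x, u s) (u t) t :=
    intervalIntegral.integral_hasDerivAt_right hI
      ((h.cont.mono Ioi_subset_Ici_self).stronglyMeasurableAtFilter isOpen_Ioi t ht)
      (h.cont.continuousAt (Ici_mem_nhds ht))
  have h2 : HasDerivAt (fun x => tail u T - ∫ s in T..x, u s) (-u t) t := by
    simpa using h1.const_sub (tail u T)
  refine h2.congr_of_eventuallyEq ?_
  filter_upwards [Ioi_mem_nhds ht] with x hx using h.tail_eq (le_of_lt hx)

lemma continuousOn_tail (h : Decays u T C n) : ContinuousOn (tail u) (Ici T) := by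
  have h1 : ContinuousOn (fun x => tail u T - ∫ s in T..x, u s) (Ici T) := by
    refine continuousOn_const.sub fun x hx => ?_
    have hi : IntegrableOn u (Icc T (x + 1)) :=
      (h.cont.mono Icc_subset_Ici_self).integrableOn_Icc
    have := intervalIntegral.continuousOn_primitive_interval
      (μ := volume) (f := u) (a := T) (b := x + 1)
      (by rwa [uIcc_of_le (by linarith [mem_Ici.1 hx])])
    rw [uIcc_of_le (by linarith [mem_Ici.1 hx])] at this
    refine (this x ⟨hx, by linarith⟩).mono_of_mem_nhdsWithin ?_
    rw [mem_nhdsWithin]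
    exact ⟨Iio (x + 1), isOpen_Iio, by simp, fun y hy => ⟨hy.2, le_of_lt hy.1⟩⟩
  exact h1.congr fun x hx => h.tail_eq hx

lemma tail_sub (hu : Decays u T C n) {n' : ℕ} (hv : Decays v T C' n') {t : ℝ} (ht : T ≤ t) :
    tail (fun s => u s - v s) t = tail u t - tail v t :=
  integral_sub (hu.integrableOn_Ioi ht) (hv.integrableOn_Ioi ht)

lemma tendsto_tail (h : Decays u T C n) : Tendsto (tail u) atTop (𝓝 0) := by
  have h1 : Tendsto (fun t : ℝ => C / (((n : ℝ) + 1) * t ^ (n + 1))) atTop (𝓝 0) :=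
    ((tendsto_pow_atTop n.succ_ne_zero).const_mul_atTop (by positivity)).const_div_atTop C
  refine squeeze_zero_norm' ?_ h1
  filter_upwards [eventually_ge_atTop T] with t ht using h.abs_tail_le ht

/-- A function that tends to `0` at infinity is the tail integral of minus its derivative. -/
lemma eq_tail_of_hasDerivAt (h : Decays u T C n) (hv : ∀ t, T ≤ t → HasDerivAt v (-u t) t)
    (hv0 : Tendsto v atTop (𝓝 0)) {t : ℝ} (ht : T ≤ t) : v t = tail u t := by
  have := integral_Ioi_of_hasDerivAt_of_tendsto' (fun x hx => hv x (ht.trans hx))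
    (h.integrableOn_Ioi ht).neg hv0
  simp only [tail]
  rw [integral_neg] at this
  linarith

end Decays

lemma tail_congr {u v : ℝ → ℝ} {t : ℝ} (h : ∀ s, t < s → u s = v s) : tail u t = tail v t :=
  setIntegral_congr_fun measurableSet_Ioi fun s hs => h s hs


/-! ### The fixed point problem for the end -/

/-- Continuous functions `σ = O(t⁻²)` and `ψ = O(t⁻³)` with explicit constants. They are the error
terms in the coefficients of the reduced equations at infinity. -/
structure EndCoeffs (σ ψ : ℝ → ℝ) (C T₀ : ℝ) : Prop where
  one_le : 1 ≤ T₀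
  C_nonneg : 0 ≤ C
  contσ : ContinuousOn σ (Ioi 0)
  contψ : ContinuousOn ψ (Ioi 0)
  boundσ : ∀ s, T₀ ≤ s → |σ s| ≤ C / s ^ 2
  boundψ : ∀ s, T₀ ≤ s → |ψ s| ≤ C / s ^ 3

/-- The starting time `T` and the bound `M` are large enough, depending on the parameters
`P = (G, lam)`, for the fixed point operator to be a contraction on perturbations of size
`M / s ^ 2` over `[T, ∞)`. -/
structure Admissible (m C T₀ M T : ℝ) (P : ℝ × ℝ) : Prop where
  hG : m ≤ P.1
  hT₀ : T₀ ≤ T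
  hM : C * |P.1| + 1 ≤ M
  hCM : C + M ≤ T
  hlam : 16 * P.2 ^ 2 ≤ T

/-- Minus the right-hand side of the equation for `h = g - G`, once `f` has been eliminated by
`f = e^{(m - G) s} s^{-5/2} lam exp (∫_s^∞ (σ + h))`. -/
noncomputable def source (σ ψ : ℝ → ℝ) (m : ℝ) (P : ℝ × ℝ) (h : ℝ → ℝ) (s : ℝ) : ℝ :=
  ψ s * (P.1 + h s) +
    Real.exp (2 * ((m - P.1) * s)) / s ^ 5 * (P.2 ^ 2 * Real.exp (2 * tail (fun r => σ r + h r) s))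

/-- `h = g - G` solves the integral equation of the instanton end on `[T, ∞)`, with
`|h s| ≤ M / s ^ 2`. -/
structure IsProfile (σ ψ : ℝ → ℝ) (m : ℝ) (P : ℝ × ℝ) (M T : ℝ) (h : ℝ → ℝ) : Prop where
  decays : Decays h T M 0
  eq : ∀ t, T ≤ t → h t = tail (source σ ψ m P h) t

lemma exp_two_le : Real.exp 2 ≤ 8 := by
  have h := Real.exp_one_lt_d9
  have h0 := Real.exp_pos 1
  rw [show (2 : ℝ) = 1 + 1 by norm_num, Real.exp_add]
  nlinarith

lemma abs_exp_sub_exp_le {x y c : ℝ} (hx : x ≤ c) (hy : y ≤ c) :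
    |Real.exp x - Real.exp y| ≤ Real.exp c * |x - y| := by
  have := (convex_Iic c).norm_image_sub_le_of_norm_deriv_le (f := Real.exp) (C := Real.exp c)
    (fun z _ => Real.differentiableAt_exp)
    (fun z hz => by simpa using hz) (mem_Iic.2 hy) (mem_Iic.2 hx)
  simpa using this

section Operator

variable {σ ψ : ℝ → ℝ} {m C T₀ M T : ℝ} {P P₀ : ℝ × ℝ} {h h₁ h₂ : ℝ → ℝ}

lemma Admissible.one_le_T (hc : EndCoeffs σ ψ C T₀) (ha : Admissible m C T₀ M T P) : 1 ≤ T :=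
  hc.one_le.trans ha.hT₀

lemma Admissible.one_le_M (hc : EndCoeffs σ ψ C T₀) (ha : Admissible m C T₀ M T P) : 1 ≤ M := by
  have := mul_nonneg hc.C_nonneg (abs_nonneg P.1)
  linarith [ha.hM]

lemma decays_add (hc : EndCoeffs σ ψ C T₀) (hT : T₀ ≤ T) (hh : Decays h T M 0) :
    Decays (fun r => σ r + h r) T (C + M) 0 where
  pos := hh.pos
  cont := (hc.contσ.mono fun s hs => hh.pos.trans_le hs).add hh.cont
  bound s hs := by
    refine (abs_add_le _ _).trans ?_
    rw [add_div]
    exact add_le_add (hc.boundσ s (hT.trans hs)) (hh.bound s hs)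

lemma abs_tail_le_one (hc : EndCoeffs σ ψ C T₀) (ha : Admissible m C T₀ M T P)
    (hh : Decays h T M 0) {s : ℝ} (hs : T ≤ s) : |tail (fun r => σ r + h r) s| ≤ 1 := by
  have hs0 : 0 < s := hh.pos.trans_le hs
  refine ((decays_add hc ha.hT₀ hh).abs_tail_le hs).trans ?_
  rw [div_le_one (by positivity)]
  have := ha.hCM
  simp only [CharP.cast_eq_zero, zero_add, pow_one, one_mul]
  linarith

lemma exp_tail_le (hc : EndCoeffs σ ψ C T₀) (ha : Admissible m C T₀ M T P)
    (hh : Decays h T M 0) {s : ℝ} (hs : T ≤ s) :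
    Real.exp (2 * tail (fun r => σ r + h r) s) ≤ 8 := by
  have := abs_le.1 (abs_tail_le_one hc ha hh hs)
  exact (Real.exp_le_exp.2 (by linarith)).trans exp_two_le

lemma exp_weight_le_one (ha : Admissible m C T₀ M T P) {s : ℝ} (hs : 0 ≤ s) :
    Real.exp (2 * ((m - P.1) * s)) ≤ 1 := by
  rw [Real.exp_le_one_iff]
  nlinarith [ha.hG, mul_nonneg (sub_nonneg.2 ha.hG) hs]

lemma decays_source (hc : EndCoeffs σ ψ C T₀) (ha : Admissible m C T₀ M T P)
    (hh : Decays h T M 0) : Decays (source σ ψ m P h) T M 1 where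
  pos := hh.pos
  cont := by
    have hsub : Ici T ⊆ Ioi 0 := fun s hs => hh.pos.trans_le hs
    refine ((hc.contψ.mono hsub).mul (continuousOn_const.add hh.cont)).add
      (ContinuousOn.mul (ContinuousOn.div (by fun_prop) (by fun_prop) fun s hs => ?_)
        (continuousOn_const.mul (Real.continuous_exp.comp_continuousOn
          (continuousOn_const.mul (decays_add hc ha.hT₀ hh).continuousOn_tail))))
    have : 0 < s := hsub hs
    positivity
  bound s hs := by
    have hs0 : 0 < s := hh.pos.trans_le hs
    have h1T := ha.one_le_T hc
    have h1M := ha.one_le_M hc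
    have hC := hc.C_nonneg
    have hCM := ha.hCM
    have hM := ha.hM
    have hl := ha.hlam
    have hψ := hc.boundψ s (ha.hT₀.trans hs)
    have hb : |h s| ≤ M / s ^ 2 := hh.bound s hs
    have he := exp_tail_le hc ha hh hs
    have hw := exp_weight_le_one ha hs0.le
    have h1 : |ψ s * (P.1 + h s)| ≤ C / s ^ 3 * (|P.1| + M / s ^ 2) := by
      rw [abs_mul]
      gcongr
      exact (abs_add_le _ _).trans (by gcongr)
    have h2 : |Real.exp (2 * ((m - P.1) * s)) / s ^ 5 *
        (P.2 ^ 2 * Real.exp (2 * tail (fun r => σ r + h r) s))| ≤ 1 / s ^ 5 * (P.2 ^ 2 * 8) := by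
      rw [abs_of_nonneg (by positivity)]
      gcongr
    have hCM4 : C * M ≤ s ^ 2 / 4 := by
      nlinarith [sq_nonneg (C - M), mul_self_le_mul_self (by linarith : 0 ≤ C + M) (hCM.trans hs)]
    have hl2 : P.2 ^ 2 * 8 ≤ s ^ 2 / 2 := by nlinarith
    calc |source σ ψ m P h s| ≤ C / s ^ 3 * (|P.1| + M / s ^ 2) + 1 / s ^ 5 * (P.2 ^ 2 * 8) :=
          (abs_add_le _ _).trans (add_le_add h1 h2)
      _ = (C * |P.1| + (C * M + P.2 ^ 2 * 8) / s ^ 2) / s ^ 3 := by field_simp; ring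
      _ ≤ M / s ^ (1 + 2) := by
          gcongr
          have : (C * M + P.2 ^ 2 * 8) / s ^ 2 ≤ 1 := by
            rw [div_le_one (by positivity)]; nlinarith [sq_nonneg s]
          linarith

lemma abs_source_sub_le (hc : EndCoeffs σ ψ C T₀) (ha : Admissible m C T₀ M T P)
    (hh₁ : Decays h₁ T M 0) (hh₂ : Decays h₂ T M 0) {d : ℝ}
    (hd : ∀ s, T ≤ s → |h₁ s - h₂ s| ≤ d / s ^ 2) {s : ℝ} (hs : T ≤ s) :
    |source σ ψ m P h₁ s - source σ ψ m P h₂ s| ≤ d / s ^ 3 := by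
  have hs0 : 0 < s := hh₁.pos.trans_le hs
  have h1T := ha.one_le_T hc
  have h1M := ha.one_le_M hc
  have hC := hc.C_nonneg
  have hCM := ha.hCM
  have hl := ha.hlam
  have hd0 : 0 ≤ d := by
    have := (abs_nonneg _).trans (hd s hs)
    by_contra hneg
    exact absurd this (not_le.2 (div_neg_of_neg_of_pos (not_le.1 hneg) (by positivity)))
  have hψ := hc.boundψ s (ha.hT₀.trans hs)
  have hw := exp_weight_le_one ha hs0.le
  have e₁ := abs_le.1 (abs_tail_le_one hc ha hh₁ hs)
  have e₂ := abs_le.1 (abs_tail_le_one hc ha hh₂ hs)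
  have D₁ := decays_add hc ha.hT₀ hh₁
  have D₂ := decays_add hc ha.hT₀ hh₂
  have hdiff : |tail (fun r => σ r + h₁ r) s - tail (fun r => σ r + h₂ r) s| ≤ d / s := by
    rw [← D₁.tail_sub D₂ hs]
    have : Decays (fun r => σ r + h₁ r - (σ r + h₂ r)) T d 0 :=
      ⟨hh₁.pos, D₁.cont.sub D₂.cont, fun r hr => by
        simpa using hd r hr⟩
    simpa using this.abs_tail_le hs
  have hexp : |Real.exp (2 * tail (fun r => σ r + h₁ r) s) -
      Real.exp (2 * tail (fun r => σ r + h₂ r) s)| ≤ 8 * (2 * (d / s)) := by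
    refine (abs_exp_sub_exp_le (c := 2) (by linarith) (by linarith)).trans ?_
    rw [← mul_sub, abs_mul, abs_two]
    gcongr
    exact exp_two_le
  have key : source σ ψ m P h₁ s - source σ ψ m P h₂ s = ψ s * (h₁ s - h₂ s) +
      Real.exp (2 * ((m - P.1) * s)) / s ^ 5 *
        (P.2 ^ 2 * (Real.exp (2 * tail (fun r => σ r + h₁ r) s) -
          Real.exp (2 * tail (fun r => σ r + h₂ r) s))) := by
    simp only [source]; ring
  have b1 : |ψ s * (h₁ s - h₂ s)| ≤ C / s ^ 3 * (d / s ^ 2) := by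
    rw [abs_mul]
    gcongr
    exact hd s hs
  have b2 : |Real.exp (2 * ((m - P.1) * s)) / s ^ 5 *
        (P.2 ^ 2 * (Real.exp (2 * tail (fun r => σ r + h₁ r) s) -
          Real.exp (2 * tail (fun r => σ r + h₂ r) s)))| ≤
      1 / s ^ 5 * (P.2 ^ 2 * (8 * (2 * (d / s)))) := by
    rw [abs_mul, abs_mul, abs_of_nonneg (by positivity : 0 ≤ P.2 ^ 2),
      abs_of_nonneg (by positivity : 0 ≤ Real.exp (2 * ((m - P.1) * s)) / s ^ 5)]
    gcongr
  rw [key]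
  calc _ ≤ C / s ^ 3 * (d / s ^ 2) + 1 / s ^ 5 * (P.2 ^ 2 * (8 * (2 * (d / s)))) :=
        (abs_add_le _ _).trans (add_le_add b1 b2)
    _ = ((C + 16 * P.2 ^ 2 / s) / s ^ 2) * (d / s ^ 3) := by field_simp; ring
    _ ≤ 1 * (d / s ^ 3) := by
        gcongr
        rw [div_le_one (by positivity)]
        have : 16 * P.2 ^ 2 / s ≤ 1 := by rw [div_le_one hs0]; linarith
        nlinarith
    _ = d / s ^ 3 := one_mul _

/-- The constant by which a change of the parameters changes the source term. -/
noncomputable def paramDist (C : ℝ) (P P₀ : ℝ × ℝ) : ℝ :=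
  C * |P.1 - P₀.1| + 8 * |P.2 ^ 2 - P₀.2 ^ 2| + 16 * P₀.2 ^ 2 * |P.1 - P₀.1|

lemma abs_source_param_le (hc : EndCoeffs σ ψ C T₀) (ha : Admissible m C T₀ M T P)
    (ha₀ : Admissible m C T₀ M T P₀) (hh : Decays h T M 0) {s : ℝ} (hs : T ≤ s) :
    |source σ ψ m P h s - source σ ψ m P₀ h s| ≤ paramDist C P P₀ / s ^ 3 := by
  have hs0 : 0 < s := hh.pos.trans_le hs
  have h1T := ha.one_le_T hc
  have hC := hc.C_nonneg
  have hψ := hc.boundψ s (ha.hT₀.trans hs)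
  have he := exp_tail_le hc ha hh hs
  have hw := exp_weight_le_one ha hs0.le
  have key : source σ ψ m P h s - source σ ψ m P₀ h s = ψ s * (P.1 - P₀.1) +
      (Real.exp (2 * ((m - P.1) * s)) * (P.2 ^ 2 - P₀.2 ^ 2) +
        P₀.2 ^ 2 * (Real.exp (2 * ((m - P.1) * s)) - Real.exp (2 * ((m - P₀.1) * s)))) *
        (Real.exp (2 * tail (fun r => σ r + h r) s) / s ^ 5) := by
    simp only [source]; ring
  have hE : |Real.exp (2 * ((m - P.1) * s)) - Real.exp (2 * ((m - P₀.1) * s))| ≤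
      2 * (|P.1 - P₀.1| * s) := by
    refine (abs_exp_sub_exp_le (c := 0)
      (by nlinarith [ha.hG, mul_nonneg (sub_nonneg.2 ha.hG) hs0.le])
      (by nlinarith [ha₀.hG, mul_nonneg (sub_nonneg.2 ha₀.hG) hs0.le])).trans_eq ?_
    rw [show 2 * ((m - P.1) * s) - 2 * ((m - P₀.1) * s) = -(2 * ((P.1 - P₀.1) * s)) by ring,
      abs_neg, abs_mul, abs_mul, abs_two, abs_of_pos hs0, Real.exp_zero, one_mul]
  have b1 : |ψ s * (P.1 - P₀.1)| ≤ C / s ^ 3 * |P.1 - P₀.1| := by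
    rw [abs_mul]; gcongr
  have b2 : |Real.exp (2 * ((m - P.1) * s)) * (P.2 ^ 2 - P₀.2 ^ 2) +
        P₀.2 ^ 2 * (Real.exp (2 * ((m - P.1) * s)) - Real.exp (2 * ((m - P₀.1) * s)))| ≤
      1 * |P.2 ^ 2 - P₀.2 ^ 2| + P₀.2 ^ 2 * (2 * (|P.1 - P₀.1| * s)) := by
    refine (abs_add_le _ _).trans ?_
    rw [abs_mul, abs_mul, Real.abs_exp, abs_of_nonneg (by positivity : 0 ≤ P₀.2 ^ 2)]
    gcongr
  rw [key]
  calc _ ≤ C / s ^ 3 * |P.1 - P₀.1| +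
        (1 * |P.2 ^ 2 - P₀.2 ^ 2| + P₀.2 ^ 2 * (2 * (|P.1 - P₀.1| * s))) * (8 / s ^ 5) := by
        refine (abs_add_le _ _).trans (add_le_add b1 ?_)
        rw [abs_mul, abs_of_nonneg (a := _ / s ^ 5) (by positivity)]
        gcongr
    _ = (C * |P.1 - P₀.1| + 8 * |P.2 ^ 2 - P₀.2 ^ 2| / s ^ 2 +
          16 * P₀.2 ^ 2 * |P.1 - P₀.1| / s) / s ^ 3 := by field_simp; ring
    _ ≤ paramDist C P P₀ / s ^ 3 := by
        unfold paramDist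
        gcongr
        · exact div_le_self (by positivity) (one_le_pow₀ (h1T.trans hs))
        · exact div_le_self (by positivity) (h1T.trans hs)

/-! ### Existence and stability of the fixed point -/

/-- Profiles depend Lipschitz continuously on the parameters; for equal parameters they are
equal. -/
lemma IsProfile.abs_sub_le (hc : EndCoeffs σ ψ C T₀) (ha : Admissible m C T₀ M T P)
    (ha₀ : Admissible m C T₀ M T P₀) (h1 : IsProfile σ ψ m P M T h₁)
    (h2 : IsProfile σ ψ m P₀ M T h₂) {s : ℝ} (hs : T ≤ s) :
    |h₁ s - h₂ s| ≤ paramDist C P P₀ / s ^ 2 := by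
  have hT0 := h1.decays.pos
  -- The contraction estimate halves any bound on the difference, up to the parameter error.
  have step : ∀ n : ℕ, ∀ s, T ≤ s →
      |h₁ s - h₂ s| ≤ (2 * M / 2 ^ n + paramDist C P P₀) / s ^ 2 := by
    intro n
    induction n with
    | zero =>
      intro s hs
      have hs0 := hT0.trans_le hs
      have hb1 : |h₁ s| ≤ M / s ^ 2 := h1.decays.bound s hs
      have hb2 : |h₂ s| ≤ M / s ^ 2 := h2.decays.bound s hs
      have hp : 0 ≤ paramDist C P P₀ := by
        have := hc.C_nonneg
        unfold paramDist; positivity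
      calc |h₁ s - h₂ s| ≤ M / s ^ 2 + M / s ^ 2 := (abs_sub _ _).trans (add_le_add hb1 hb2)
        _ = (2 * M / 2 ^ 0 + 0) / s ^ 2 := by ring
        _ ≤ _ := by gcongr
    | succ n ih =>
      intro s hs
      have hs0 := hT0.trans_le hs
      have S1 := decays_source hc ha h1.decays
      have S2 := decays_source hc ha₀ h2.decays
      have hdec : Decays (fun r => source σ ψ m P h₁ r - source σ ψ m P₀ h₂ r) T
          (2 * M / 2 ^ n + paramDist C P P₀ + paramDist C P P₀) 1 := by
        refine ⟨hT0, S1.cont.sub S2.cont, fun r hr => ?_⟩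
        refine (_root_.abs_sub_le _ (source σ ψ m P h₂ r) _).trans ?_
        rw [add_div _ (paramDist C P P₀)]
        exact add_le_add (abs_source_sub_le hc ha h1.decays h2.decays ih hr)
          (abs_source_param_le hc ha ha₀ h2.decays hr)
      rw [h1.eq s hs, h2.eq s hs, ← S1.tail_sub S2 hs]
      refine (hdec.abs_tail_le hs).trans_eq ?_
      push_cast
      field_simp
      ring
  have hlim : Tendsto (fun n : ℕ => (2 * M / 2 ^ n + paramDist C P P₀) / s ^ 2) atTop
      (𝓝 ((0 + paramDist C P P₀) / s ^ 2)) :=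
    (((tendsto_pow_atTop_atTop_of_one_lt one_lt_two).const_div_atTop _).add_const _).div_const _
  rw [zero_add] at hlim
  exact ge_of_tendsto' hlim fun n => step n s hs

/-- Truncation to `[-M, M]`. -/
def clamp (M x : ℝ) : ℝ := max (-M) (min M x)

lemma abs_clamp_le (hM : 0 ≤ M) (x : ℝ) : |clamp M x| ≤ M :=
  abs_le.2 ⟨le_max_left _ _, max_le (by linarith) (min_le_left _ _)⟩

lemma clamp_eq_self {x : ℝ} (hx : |x| ≤ M) : clamp M x = x := by
  rw [clamp, min_eq_right (abs_le.1 hx).2, max_eq_right (abs_le.1 hx).1]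

lemma abs_clamp_sub_le (x y : ℝ) : |clamp M x - clamp M y| ≤ |x - y| := by
  refine (abs_max_sub_max_le_max (-M) (min M x) (-M) (min M y)).trans ?_
  refine max_le (by simp) ?_
  exact (abs_min_sub_min_le_max M x M y).trans (max_le (by simp) le_rfl)

lemma continuous_clamp : Continuous (clamp M) := by
  unfold clamp; fun_prop

lemma decays_clamp (hT : 0 < T) (hM : 0 ≤ M) {z : ℝ → ℝ} (hz : Continuous z) :
    Decays (fun s => clamp M (z s) / s ^ 2) T M 0 where
  pos := hT
  cont := (continuous_clamp.comp hz).continuousOn.div (by fun_prop) fun s hs => by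
    have : 0 < s := hT.trans_le hs
    positivity
  bound s hs := by
    have : 0 < s := hT.trans_le hs
    rw [abs_div, abs_of_pos (by positivity : 0 < s ^ 2)]
    gcongr
    exact abs_clamp_le hM _

/-- The fixed point operator in the rescaled unknown `z = s² h`, constant to the left of `T` and
truncated at size `M` so that it acts on all bounded continuous functions. -/
noncomputable def profileMap (hc : EndCoeffs σ ψ C T₀) (ha : Admissible m C T₀ M T P)
    (z : BoundedContinuousFunction ℝ ℝ) : BoundedContinuousFunction ℝ ℝ :=
  have hT : 0 < T := zero_lt_one.trans_le (ha.one_le_T hc)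
  have D := decays_source hc ha
    (decays_clamp hT (zero_le_one.trans (ha.one_le_M hc)) z.continuous)
  BoundedContinuousFunction.ofNormedAddCommGroup
    (fun t => (max t T) ^ 2 * tail (source σ ψ m P fun s => clamp M (z s) / s ^ 2) (max t T))
    (((continuous_id.max continuous_const).pow 2).mul
      (D.continuousOn_tail.comp_continuous (continuous_id.max continuous_const)
        fun t => le_max_right t T))
    (M / 2) (fun t => D.abs_sq_mul_tail_le (le_max_right t T))

lemma profileMap_apply (hc : EndCoeffs σ ψ C T₀) (ha : Admissible m C T₀ M T P)
    (z : BoundedContinuousFunction ℝ ℝ) (t : ℝ) :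
    profileMap hc ha z t = (max t T) ^ 2 *
      tail (source σ ψ m P fun s => clamp M (z s) / s ^ 2) (max t T) := rfl

lemma abs_profileMap_le (hc : EndCoeffs σ ψ C T₀) (ha : Admissible m C T₀ M T P)
    (z : BoundedContinuousFunction ℝ ℝ) (t : ℝ) : |profileMap hc ha z t| ≤ M := by
  have hM := ha.one_le_M hc
  have D := decays_source hc ha (decays_clamp (zero_lt_one.trans_le (ha.one_le_T hc))
    (zero_le_one.trans hM) z.continuous)
  rw [profileMap_apply]
  linarith [D.abs_sq_mul_tail_le (le_max_right t T)]

lemma contractingWith_profileMap (hc : EndCoeffs σ ψ C T₀) (ha : Admissible m C T₀ M T P) :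
    ContractingWith (1 / 2) (profileMap hc ha) := by
  refine ⟨by rw [← NNReal.coe_lt_coe]; norm_num, LipschitzWith.of_dist_le_mul fun z w => ?_⟩
  have hT : 0 < T := zero_lt_one.trans_le (ha.one_le_T hc)
  have hM : 0 ≤ M := zero_le_one.trans (ha.one_le_M hc)
  rw [BoundedContinuousFunction.dist_le (by positivity)]
  intro t
  have h1 : T ≤ max t T := le_max_right t T
  have Dz := decays_clamp hT hM z.continuous
  have Dw := decays_clamp hT hM w.continuous
  have Sz := decays_source hc ha Dz
  have Sw := decays_source hc ha Dw
  have hd : Decays (fun s => source σ ψ m P (fun s => clamp M (z s) / s ^ 2) s -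
      source σ ψ m P (fun s => clamp M (w s) / s ^ 2) s) T (dist z w) 1 := by
    refine ⟨hT, Sz.cont.sub Sw.cont, fun s hs => abs_source_sub_le hc ha Dz Dw ?_ hs⟩
    intro r hr
    have hr0 : 0 < r := hT.trans_le hr
    rw [← sub_div, abs_div, abs_of_pos (by positivity : 0 < r ^ 2)]
    gcongr
    exact (abs_clamp_sub_le _ _).trans (by
      simpa [Real.dist_eq] using BoundedContinuousFunction.dist_coe_le_dist (f := z) (g := w) r)
  rw [Real.dist_eq, profileMap_apply, profileMap_apply, ← mul_sub, ← Sz.tail_sub Sw h1]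
  refine (hd.abs_sq_mul_tail_le h1).trans_eq ?_
  push_cast
  ring

theorem exists_isProfile (hc : EndCoeffs σ ψ C T₀) (ha : Admissible m C T₀ M T P) :
    ∃ h, IsProfile σ ψ m P M T h := by
  have hT : 0 < T := zero_lt_one.trans_le (ha.one_le_T hc)
  have hM : 0 ≤ M := zero_le_one.trans (ha.one_le_M hc)
  have hK := contractingWith_profileMap hc ha
  set z := ContractingWith.fixedPoint _ hK with hz
  have hfix : profileMap hc ha z = z := hK.fixedPoint_isFixedPt
  have hzM : ∀ s, |z s| ≤ M := fun s => by
    rw [← hfix]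
    exact abs_profileMap_le hc ha z s
  refine ⟨fun s => clamp M (z s) / s ^ 2, decays_clamp hT hM z.continuous, fun t ht => ?_⟩
  have ht0 : 0 < t := hT.trans_le ht
  have h1 : z t = t ^ 2 * tail (source σ ψ m P fun s => clamp M (z s) / s ^ 2) t := by
    conv_lhs => rw [← hfix]
    rw [profileMap_apply, max_eq_left ht]
  rw [clamp_eq_self (hzM t), div_eq_iff (by positivity), h1, mul_comm]

/-- A profile restricts to later starting times and weaker bounds. -/
lemma IsProfile.mono (hp : IsProfile σ ψ m P M T h) {M' T' : ℝ} (hM : M ≤ M') (hT : T ≤ T') :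
    IsProfile σ ψ m P M' T' h :=
  ⟨hp.decays.mono hT hM, fun t ht => hp.eq t (hT.trans ht)⟩

end Operator


/-! ### Solutions of the reduced equations near infinity -/

/-- `(f, g)` solves `f' = -(φ + g) f`, `g' = -ψ g - f²` on `(T, ∞)`. -/
def SolvesOn (φ ψ : ℝ → ℝ) (T : ℝ) (f g : ℝ → ℝ) : Prop :=
  ∀ t, T < t → HasDerivAt f (-((φ t + g t) * f t)) t ∧ HasDerivAt g (-(ψ t * g t + f t ^ 2)) t

/-- The function `f` determined by `h = g - G` through the linear equation `f' = -(φ + g) f` and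
the leading coefficient `lam` at infinity, where `φ = -m + 5 / (2 t) + σ`. -/
noncomputable def endF (σ : ℝ → ℝ) (m : ℝ) (P : ℝ × ℝ) (h : ℝ → ℝ) (t : ℝ) : ℝ :=
  Real.exp ((m - P.1) * t) * t ^ (-(5 / 2) : ℝ) *
    (P.2 * Real.exp (tail (fun r => σ r + h r) t))

lemma SolvesOn.mono {φ ψ f g : ℝ → ℝ} {T T' : ℝ} (hs : SolvesOn φ ψ T f g) (hT : T ≤ T') :
    SolvesOn φ ψ T' f g := fun t ht => hs t (hT.trans_lt ht)

lemma rpow_neg_five_half_sq {t : ℝ} (ht : 0 < t) : (t ^ (-(5 / 2) : ℝ)) ^ 2 = 1 / t ^ 5 := by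
  rw [← Real.rpow_natCast, ← Real.rpow_mul ht.le]
  norm_num

lemma rpow_neg_seven_half {t : ℝ} (ht : 0 < t) :
    t ^ (-(7 / 2) : ℝ) = t ^ (-(5 / 2) : ℝ) / t := by
  rw [show (-(7 / 2) : ℝ) = -(5 / 2) - 1 by norm_num, Real.rpow_sub_one ht.ne']

section

variable {φ ψ σ : ℝ → ℝ} {m C T₀ M T : ℝ} {P P₀ : ℝ × ℝ} {h f g : ℝ → ℝ}

lemma endF_sq {t : ℝ} (ht : 0 < t) : endF σ m P h t ^ 2 =
    Real.exp (2 * ((m - P.1) * t)) / t ^ 5 *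
      (P.2 ^ 2 * Real.exp (2 * tail (fun r => σ r + h r) t)) := by
  simp only [endF, mul_pow, rpow_neg_five_half_sq ht, ← Real.exp_nat_mul]
  push_cast
  ring

lemma source_eq {t : ℝ} (ht : 0 < t) :
    source σ ψ m P h t = ψ t * (P.1 + h t) + endF σ m P h t ^ 2 := by
  rw [endF_sq ht, source]

lemma hasDerivAt_endF (D : Decays (fun r => σ r + h r) T C 0) {t : ℝ} (ht : T < t) :
    HasDerivAt (endF σ m P h)
      (-((σ t - m + 5 / (2 * t) + (P.1 + h t)) * endF σ m P h t)) t := by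
  have ht0 : 0 < t := D.pos.trans ht
  have h1 : HasDerivAt (fun t : ℝ => Real.exp ((m - P.1) * t))
      (Real.exp ((m - P.1) * t) * ((m - P.1) * 1)) t :=
    ((hasDerivAt_id t).const_mul _).exp
  have h2 : HasDerivAt (fun t : ℝ => t ^ (-(5 / 2) : ℝ))
      (-(5 / 2) * t ^ (-(5 / 2) - 1 : ℝ)) t := Real.hasDerivAt_rpow_const (Or.inl ht0.ne')
  have h3 := ((D.hasDerivAt_tail ht).exp).const_mul P.2
  refine ((h1.mul h2).mul h3).congr_deriv ?_
  rw [Real.rpow_sub_one ht0.ne']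
  simp only [endF, Pi.mul_apply]
  field_simp
  ring

lemma IsProfile.solvesOn (hφ : ∀ t, 0 < t → φ t = σ t - m + 5 / (2 * t))
    (hc : EndCoeffs σ ψ C T₀) (ha : Admissible m C T₀ M T P) (hp : IsProfile σ ψ m P M T h) :
    SolvesOn φ ψ T (endF σ m P h) (fun t => P.1 + h t) := by
  intro t ht
  have ht0 : 0 < t := hp.decays.pos.trans ht
  refine ⟨?_, ?_⟩
  · rw [hφ t ht0]
    exact hasDerivAt_endF (decays_add hc ha.hT₀ hp.decays) ht
  · rw [← source_eq ht0]
    refine HasDerivAt.const_add _ ?_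
    refine ((decays_source hc ha hp.decays).hasDerivAt_tail ht).congr_of_eventuallyEq ?_
    filter_upwards [Ioi_mem_nhds ht] with x hx using hp.eq x (le_of_lt hx)

lemma Decays.tendsto_zero {n : ℕ} (hh : Decays h T M n) : Tendsto h atTop (𝓝 0) := by
  have h1 : Tendsto (fun t : ℝ => M / t ^ (n + 2)) atTop (𝓝 0) :=
    (tendsto_pow_atTop (by omega)).const_div_atTop M
  refine squeeze_zero_norm' ?_ h1
  filter_upwards [eventually_ge_atTop T] with t ht using hh.bound t ht

lemma IsProfile.hasEndBehaviour {ℓ : ℝ} (hc : EndCoeffs σ ψ C T₀)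
    (ha : Admissible ℓ⁻¹ C T₀ M T P) (hp : IsProfile σ ψ ℓ⁻¹ P M T h) :
    HasEndBehaviour ℓ P.1 P.2 (endF σ ℓ⁻¹ P h) (fun t => P.1 + h t) := by
  refine ⟨by simpa using hp.decays.tendsto_zero.const_add P.1, ?_⟩
  refine IsBigO.of_bound (|P.2| * (Real.exp 1 * (C + M))) ?_
  filter_upwards [eventually_ge_atTop T] with t ht
  have ht0 : 0 < t := hp.decays.pos.trans_le ht
  have hI1 := abs_tail_le_one hc ha hp.decays ht
  have hI := (decays_add hc ha.hT₀ hp.decays).abs_tail_le ht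
  set I := tail (fun r => σ r + h r) t with hIdef
  have hexp : |Real.exp I - 1| ≤ Real.exp 1 * ((C + M) / t) := by
    have := abs_exp_sub_exp_le (abs_le.1 hI1).2 (zero_le_one' ℝ)
    rw [Real.exp_zero, sub_zero] at this
    refine this.trans ?_
    gcongr
    simpa using hI
  rw [rpow_neg_seven_half ht0, Real.norm_eq_abs, Real.norm_eq_abs]
  have e1 : endF σ ℓ⁻¹ P h t - Real.exp ((ℓ⁻¹ - P.1) * t) * (P.2 * t ^ (-(5 / 2) : ℝ)) =
      Real.exp ((ℓ⁻¹ - P.1) * t) * t ^ (-(5 / 2) : ℝ) * (P.2 * (Real.exp I - 1)) := by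
    simp only [endF, ← hIdef]; ring
  have hr : 0 < t ^ (-(5 / 2) : ℝ) := Real.rpow_pos_of_pos ht0 _
  rw [e1, abs_mul, abs_mul P.2, abs_of_pos (by positivity :
    0 < Real.exp ((ℓ⁻¹ - P.1) * t) * t ^ (-(5 / 2) : ℝ)), abs_of_pos (by positivity :
    0 < Real.exp ((ℓ⁻¹ - P.1) * t) * (t ^ (-(5 / 2) : ℝ) / t))]
  calc _ ≤ Real.exp ((ℓ⁻¹ - P.1) * t) * t ^ (-(5 / 2) : ℝ) *
        (|P.2| * (Real.exp 1 * ((C + M) / t))) := by gcongr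
    _ = _ := by ring

/-- Every solution with the prescribed behaviour at infinity comes from a profile. -/
lemma exists_isProfile_of_hasEndBehaviour {ℓ T' : ℝ}
    (hφ : ∀ t, 0 < t → φ t = σ t - ℓ⁻¹ + 5 / (2 * t)) (hc : EndCoeffs σ ψ C T₀)
    (hG : ℓ⁻¹ ≤ P.1) (hs : SolvesOn φ ψ T' f g) (he : HasEndBehaviour ℓ P.1 P.2 f g) :
    ∃ M T, IsProfile σ ψ ℓ⁻¹ P M T (fun t => g t - P.1) ∧
      ∀ t, T ≤ t → f t = endF σ ℓ⁻¹ P (fun t => g t - P.1) t := by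
  obtain ⟨hg, hf⟩ := he
  obtain ⟨c, hc0, hcb⟩ := hf.exists_nonneg
  rw [isBigOWith_iff] at hcb
  have hh0 : Tendsto (fun t => g t - P.1) atTop (𝓝 0) := by simpa using hg.sub_const P.1
  have hh1 : ∀ᶠ t in atTop, |g t - P.1| ≤ 1 := by
    have := hh0.norm.eventually (gt_mem_nhds (by simp : ‖(0 : ℝ)‖ < 1))
    filter_upwards [this] with t ht using le_of_lt ht
  obtain ⟨T₁, hT₁⟩ := eventually_atTop.1 (hcb.and hh1)
  set T₂ := max (max T₁ T₀) (T' + 1) with hT₂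
  have l1 : T₁ ≤ T₂ := (le_max_left _ _).trans (le_max_left _ _)
  have l2 : T₀ ≤ T₂ := (le_max_right _ _).trans (le_max_left _ _)
  have l3 : T' < T₂ := (lt_add_one T').trans_le (le_max_right _ _)
  have hT₂1 : 1 ≤ T₂ := hc.one_le.trans l2
  have hC := hc.C_nonneg
  have hw : Decays (fun t => ψ t * g t + f t ^ 2) T₂
      (C * (|P.1| + 1) + (|P.2| + c) ^ 2) 1 := by
    refine ⟨by linarith, ?_, fun t ht => ?_⟩
    · have hsub : Ici T₂ ⊆ Ioi 0 := fun s (hs : T₂ ≤ s) => mem_Ioi.2 (by linarith)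
      have hgc : ContinuousOn g (Ici T₂) := fun s hs' =>
        (hs s (l3.trans_le hs')).2.continuousAt.continuousWithinAt
      have hfc : ContinuousOn f (Ici T₂) := fun s hs' =>
        (hs s (l3.trans_le hs')).1.continuousAt.continuousWithinAt
      exact ((hc.contψ.mono hsub).mul hgc).add (hfc.pow 2)
    · have ht1 : 1 ≤ t := hT₂1.trans ht
      have ht0 : 0 < t := by linarith
      have hr : 0 < t ^ (-(5 / 2) : ℝ) := Real.rpow_pos_of_pos ht0 _
      obtain ⟨hfb, hgb⟩ := hT₁ t (l1.trans ht)
      have hE : Real.exp ((ℓ⁻¹ - P.1) * t) ≤ 1 := by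
        rw [Real.exp_le_one_iff]
        nlinarith [mul_nonneg (sub_nonneg.2 hG) ht0.le]
      have hfb' : |f t| ≤ (|P.2| + c) * t ^ (-(5 / 2) : ℝ) := by
        rw [rpow_neg_seven_half ht0, Real.norm_eq_abs, Real.norm_eq_abs, abs_of_pos (by positivity :
          0 < Real.exp ((ℓ⁻¹ - P.1) * t) * (t ^ (-(5 / 2) : ℝ) / t))] at hfb
        have h1 : |f t| ≤ |Real.exp ((ℓ⁻¹ - P.1) * t) * (P.2 * t ^ (-(5 / 2) : ℝ))| +
            c * (Real.exp ((ℓ⁻¹ - P.1) * t) * (t ^ (-(5 / 2) : ℝ) / t)) := by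
          have := abs_sub_abs_le_abs_sub (f t)
            (Real.exp ((ℓ⁻¹ - P.1) * t) * (P.2 * t ^ (-(5 / 2) : ℝ)))
          linarith
        rw [abs_mul, abs_mul, Real.abs_exp, abs_of_pos hr] at h1
        have h2 : t ^ (-(5 / 2) : ℝ) / t ≤ t ^ (-(5 / 2) : ℝ) := div_le_self hr.le ht1
        calc |f t| ≤ _ := h1
          _ ≤ 1 * (|P.2| * t ^ (-(5 / 2) : ℝ)) + c * (1 * t ^ (-(5 / 2) : ℝ)) := by gcongr
          _ = _ := by ring
      have hf2 : f t ^ 2 ≤ (|P.2| + c) ^ 2 / t ^ 3 := by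
        calc f t ^ 2 = |f t| ^ 2 := (sq_abs _).symm
          _ ≤ ((|P.2| + c) * t ^ (-(5 / 2) : ℝ)) ^ 2 := by gcongr
          _ = (|P.2| + c) ^ 2 / t ^ 5 := by rw [mul_pow, rpow_neg_five_half_sq ht0]; ring
          _ ≤ _ := by gcongr; norm_num
      have hg1 : |g t| ≤ |P.1| + 1 := by
        have := abs_sub_abs_le_abs_sub (g t) P.1
        linarith
      rw [add_div]
      refine (abs_add_le _ _).trans (add_le_add ?_ (by rwa [abs_of_nonneg (sq_nonneg _)]))
      rw [abs_mul]
      calc |ψ t| * |g t| ≤ C / t ^ 3 * (|P.1| + 1) := by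
            gcongr
            exact hc.boundψ t (l2.trans ht)
        _ = _ := by ring
  set M' := C * (|P.1| + 1) + (|P.2| + c) ^ 2 with hM'
  have hM'0 : 0 ≤ M' := by positivity
  have htail : ∀ t, T₂ ≤ t → g t - P.1 = tail (fun t => ψ t * g t + f t ^ 2) t := fun t ht =>
    hw.eq_tail_of_hasDerivAt (fun x hx => ((hs x (l3.trans_le hx)).2).sub_const _) hh0 ht
  have hdec : Decays (fun t => g t - P.1) T₂ M' 0 := by
    refine ⟨by linarith, fun s hs' =>
      ((hs s (l3.trans_le hs')).2.sub_const _).continuousAt.continuousWithinAt, fun t ht => ?_⟩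
    have ht0 : 0 < t := by linarith
    rw [htail t ht]
    refine (hw.abs_tail_le ht).trans ?_
    have : ((1 : ℕ) + 1 : ℝ) * t ^ (1 + 1) ≥ t ^ (0 + 2) := by
      push_cast
      nlinarith [sq_nonneg t]
    gcongr
  have hD := decays_add hc l2 hdec
  -- The linear equation for `f` shows that the quotient by the solution with `lam = 1` is constant.
  have hfe : ∀ t, T₂ + 1 ≤ t → f t = endF σ ℓ⁻¹ P (fun t => g t - P.1) t := by
    set e := endF σ ℓ⁻¹ (P.1, 1) (fun t => g t - P.1) with hedef
    have hepos : ∀ t, 0 < t → 0 < e t := fun t ht => by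
      have hr : 0 < t ^ (-(5 / 2) : ℝ) := Real.rpow_pos_of_pos ht _
      simp only [hedef, endF]; positivity
    have hQ : ∀ t, T₂ + 1 ≤ t → HasDerivAt (fun t => f t / e t - P.2) (-(fun _ => (0 : ℝ)) t) t := by
      intro t ht
      have ht0 : 0 < t := by linarith
      have h1 := (hs t (by linarith)).1
      have h2 := hasDerivAt_endF (m := ℓ⁻¹) (P := (P.1, 1)) hD (show T₂ < t by linarith)
      refine ((h1.div h2 (hepos t ht0).ne').sub_const _).congr_deriv ?_
      rw [← hedef, hφ t ht0]
      have := (hepos t ht0).ne'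
      field_simp
      ring
    have hlim : Tendsto (fun t => f t / e t - P.2) atTop (𝓝 0) := by
      have h1 : Tendsto (fun t => (f t - Real.exp ((ℓ⁻¹ - P.1) * t) * (P.2 * t ^ (-(5 / 2) : ℝ))) /
          (Real.exp ((ℓ⁻¹ - P.1) * t) * t ^ (-(5 / 2) : ℝ))) atTop (𝓝 0) := by
        refine squeeze_zero_norm' ?_ (tendsto_id.const_div_atTop c)
        filter_upwards [eventually_ge_atTop T₂] with t ht
        have ht0 : 0 < t := by linarith
        have hr : 0 < t ^ (-(5 / 2) : ℝ) := Real.rpow_pos_of_pos ht0 _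
        have := (hT₁ t (l1.trans ht)).1
        rw [rpow_neg_seven_half ht0] at this
        rw [← mul_div_assoc, norm_div, Real.norm_of_nonneg ht0.le] at this
        rw [norm_div, div_le_iff₀ (norm_pos_iff.2 (by positivity))]
        refine this.trans_eq ?_
        rw [id]
        ring
      have h2 : Tendsto (fun t => Real.exp (-tail (fun r => σ r + (g r - P.1)) t)) atTop (𝓝 1) := by
        simpa [Function.comp_def] using
          (Real.continuous_exp.tendsto _).comp hD.tendsto_tail.neg
      have h3 := ((h1.add_const P.2).mul h2).sub_const P.2
      simp only [zero_add, mul_one, sub_self] at h3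
      refine h3.congr' ?_
      filter_upwards [eventually_gt_atTop 0] with t ht0
      have hr : 0 < t ^ (-(5 / 2) : ℝ) := Real.rpow_pos_of_pos ht0 _
      simp only [hedef, endF, Real.exp_neg, one_mul]
      field_simp
      ring
    have hz : Decays (fun _ => (0 : ℝ)) (T₂ + 1) 0 0 :=
      ⟨by linarith, continuousOn_const, fun s hs => by simp⟩
    intro t ht
    have ht0 : 0 < t := by linarith
    have h0 : f t / e t - P.2 = 0 := by
      rw [hz.eq_tail_of_hasDerivAt hQ hlim ht]
      simp [tail]
    have h1 : f t = P.2 * e t := by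
      rw [← div_eq_iff (hepos t ht0).ne']; linarith
    rw [h1, hedef]
    simp only [endF]
    ring
  refine ⟨M', T₂ + 1, ⟨hdec.mono (by linarith) le_rfl, fun t ht => ?_⟩, hfe⟩
  rw [htail t (by linarith)]
  refine tail_congr fun s hs' => ?_
  rw [source_eq (by linarith : 0 < s), ← hfe s (by linarith)]
  ring

/-- Two solutions that agree at one time agree at all earlier times at which both exist. -/
lemma SolvesOn.eq_of_eq {f₁ g₁ f₂ g₂ : ℝ → ℝ} (hT : 0 ≤ T) (hφ : ContinuousOn φ (Ioi 0))
    (hψ : ContinuousOn ψ (Ioi 0)) (h₁ : SolvesOn φ ψ T f₁ g₁) (h₂ : SolvesOn φ ψ T f₂ g₂)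
    {t₁ : ℝ} (hf : f₁ t₁ = f₂ t₁) (hg : g₁ t₁ = g₂ t₁) {t : ℝ} (ht : T < t) (htt : t ≤ t₁) :
    f₁ t = f₂ t ∧ g₁ t = g₂ t := by
  have hsub : Icc t t₁ ⊆ Ioi 0 := fun s hs => hT.trans_lt (ht.trans_le hs.1)
  have hlt : ∀ s ∈ Icc t t₁, T < s := fun s hs => ht.trans_le hs.1
  have cf₁ : ContinuousOn f₁ (Icc t t₁) := fun s hs =>
    (h₁ s (hlt s hs)).1.continuousAt.continuousWithinAt
  have cf₂ : ContinuousOn f₂ (Icc t t₁) := fun s hs =>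
    (h₂ s (hlt s hs)).1.continuousAt.continuousWithinAt
  have cg₁ : ContinuousOn g₁ (Icc t t₁) := fun s hs =>
    (h₁ s (hlt s hs)).2.continuousAt.continuousWithinAt
  obtain ⟨B₁, hB₁⟩ := isCompact_Icc.exists_bound_of_continuousOn ((hφ.mono hsub).add cg₁)
  obtain ⟨B₂, hB₂⟩ := isCompact_Icc.exists_bound_of_continuousOn cf₂
  obtain ⟨B₃, hB₃⟩ := isCompact_Icc.exists_bound_of_continuousOn (hψ.mono hsub)
  obtain ⟨B₄, hB₄⟩ := isCompact_Icc.exists_bound_of_continuousOn (cf₁.add cf₂)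
  set K := 2 * (|B₁| + |B₂| + |B₃| + |B₄|) with hK
  set N : ℝ → ℝ := fun s => (f₁ s - f₂ s) ^ 2 + (g₁ s - g₂ s) ^ 2 with hN
  -- The difference satisfies a linear system, so `N` decreases at most exponentially.
  have hd : ∀ s ∈ Icc t t₁, ∃ N', HasDerivAt N N' s ∧ -(K * N s) ≤ N' := by
    intro s hs
    obtain ⟨a1, b1⟩ := h₁ s (hlt s hs)
    obtain ⟨a2, b2⟩ := h₂ s (hlt s hs)
    refine ⟨_, ((a1.sub a2).pow 2).add ((b1.sub b2).pow 2), ?_⟩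
    have k1 : |φ s + g₁ s| ≤ |B₁| := (hB₁ s hs).trans (le_abs_self _)
    have k2 : |f₂ s| ≤ |B₂| := (hB₂ s hs).trans (le_abs_self _)
    have k3 : |ψ s| ≤ |B₃| := (hB₃ s hs).trans (le_abs_self _)
    have k4 : |f₁ s + f₂ s| ≤ |B₄| := (hB₄ s hs).trans (le_abs_self _)
    set x := f₁ s - f₂ s with hx
    set y := g₁ s - g₂ s with hy
    have hxy : |x * y| ≤ (x ^ 2 + y ^ 2) / 2 := by
      rw [abs_le]; constructor <;> nlinarith [sq_nonneg (x + y), sq_nonneg (x - y)]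
    have q1 : (φ s + g₁ s) * x ^ 2 ≤ |B₁| * x ^ 2 :=
      mul_le_mul_of_nonneg_right ((le_abs_self _).trans k1) (sq_nonneg _)
    have q3 : ψ s * y ^ 2 ≤ |B₃| * y ^ 2 :=
      mul_le_mul_of_nonneg_right ((le_abs_self _).trans k3) (sq_nonneg _)
    have q2 : f₂ s * (x * y) ≤ |B₂| * ((x ^ 2 + y ^ 2) / 2) := by
      refine (le_abs_self _).trans ?_
      rw [abs_mul]; gcongr
    have q4 : (f₁ s + f₂ s) * (x * y) ≤ |B₄| * ((x ^ 2 + y ^ 2) / 2) := by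
      refine (le_abs_self _).trans ?_
      rw [abs_mul]; gcongr
    have e1 : -((φ s + g₁ s) * f₁ s) - -((φ s + g₂ s) * f₂ s) =
        -((φ s + g₁ s) * x) - f₂ s * y := by rw [hx, hy]; ring
    have e2 : -(ψ s * g₁ s + f₁ s ^ 2) - -(ψ s * g₂ s + f₂ s ^ 2) =
        -(ψ s * y) - (f₁ s + f₂ s) * x := by rw [hx, hy]; ring
    have p1 := mul_nonneg (abs_nonneg B₁) (sq_nonneg y)
    have p3 := mul_nonneg (abs_nonneg B₃) (sq_nonneg x)
    have p2 := mul_nonneg (abs_nonneg B₂) (add_nonneg (sq_nonneg x) (sq_nonneg y))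
    have p4 := mul_nonneg (abs_nonneg B₄) (add_nonneg (sq_nonneg x) (sq_nonneg y))
    simp only [Pi.sub_apply, hN, hK, ← hx, ← hy]
    rw [e1, e2]
    push_cast
    nlinarith
  have hmono : MonotoneOn (fun s => N s * Real.exp (K * s)) (Icc t t₁) := by
    have hder : ∀ s ∈ Icc t t₁, ∃ D, HasDerivAt (fun s => N s * Real.exp (K * s)) D s ∧ 0 ≤ D := by
      intro s hs
      obtain ⟨N', hN', hb⟩ := hd s hs
      refine ⟨_, hN'.mul (((hasDerivAt_id s).const_mul K).exp), ?_⟩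
      have : 0 ≤ (N' + K * N s) * Real.exp (K * s) :=
        mul_nonneg (by linarith) (Real.exp_pos _).le
      simp only [id]
      linarith
    refine monotoneOn_of_deriv_nonneg (convex_Icc _ _) (fun s hs => ?_) (fun s hs => ?_)
      fun s hs => ?_
    · obtain ⟨D, hD, -⟩ := hder s hs
      exact hD.continuousAt.continuousWithinAt
    · obtain ⟨D, hD, -⟩ := hder s (interior_subset hs)
      exact hD.differentiableAt.differentiableWithinAt
    · obtain ⟨D, hD, h0⟩ := hder s (interior_subset hs)
      rwa [hD.deriv]
  have h0 := hmono (left_mem_Icc.2 htt) (right_mem_Icc.2 htt) htt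
  simp only [hN, hf, hg, sub_self] at h0
  have hE := Real.exp_pos (K * t)
  have hNt : (f₁ t - f₂ t) ^ 2 + (g₁ t - g₂ t) ^ 2 ≤ 0 := by
    by_contra hpos
    have := mul_pos (not_le.1 hpos) hE
    norm_num at h0
    linarith
  constructor <;> nlinarith [sq_nonneg (f₁ t - f₂ t), sq_nonneg (g₁ t - g₂ t)]

lemma SolvesOn.contDiffOn (hT : 0 ≤ T) (hφ : ContDiffOn ℝ ∞ φ (Ioi 0))
    (hψ : ContDiffOn ℝ ∞ ψ (Ioi 0)) (hs : SolvesOn φ ψ T f g) :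
    ContDiffOn ℝ ∞ f (Ioi T) ∧ ContDiffOn ℝ ∞ g (Ioi T) := by
  have hsub : Ioi T ⊆ Ioi 0 := Ioi_subset_Ioi hT
  have key : ∀ n : ℕ, ContDiffOn ℝ n f (Ioi T) ∧ ContDiffOn ℝ n g (Ioi T) := by
    intro n
    induction n with
    | zero =>
      simp only [CharP.cast_eq_zero, contDiffOn_zero]
      exact ⟨fun t ht => (hs t ht).1.continuousAt.continuousWithinAt,
        fun t ht => (hs t ht).2.continuousAt.continuousWithinAt⟩
    | succ n ih =>
      obtain ⟨hf, hg⟩ := ih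
      have hφn : ContDiffOn ℝ n φ (Ioi T) := (hφ.mono hsub).of_le (by exact_mod_cast le_top)
      have hψn : ContDiffOn ℝ n ψ (Ioi T) := (hψ.mono hsub).of_le (by exact_mod_cast le_top)
      push_cast
      rw [contDiffOn_succ_iff_deriv_of_isOpen isOpen_Ioi,
        contDiffOn_succ_iff_deriv_of_isOpen isOpen_Ioi]
      refine ⟨⟨fun t ht => (hs t ht).1.differentiableAt.differentiableWithinAt, by simp, ?_⟩,
        ⟨fun t ht => (hs t ht).2.differentiableAt.differentiableWithinAt, by simp, ?_⟩⟩
      · exact (((hφn.add hg).mul hf).neg).congr fun t ht => (hs t ht).1.deriv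
      · exact (((hψn.mul hg).add (hf.pow 2)).neg).congr fun t ht => (hs t ht).2.deriv
  exact ⟨contDiffOn_infty.2 fun n => (key n).1, contDiffOn_infty.2 fun n => (key n).2⟩

lemma abs_endF_sub_le {h₀ : ℝ → ℝ} (hc : EndCoeffs σ ψ C T₀) (ha : Admissible m C T₀ M T P)
    (ha₀ : Admissible m C T₀ M T P₀) (hp : IsProfile σ ψ m P M T h)
    (hp₀ : IsProfile σ ψ m P₀ M T h₀) {t : ℝ} (ht : T ≤ t) :
    |endF σ m P h t - endF σ m P₀ h₀ t| ≤
      Real.exp 1 * |P.2 - P₀.2| +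
        |P₀.2| * (Real.exp 1 * (|P.1 - P₀.1| * t + paramDist C P P₀)) := by
  have hT1 := ha.one_le_T hc
  have ht1 : 1 ≤ t := hT1.trans ht
  have ht0 : 0 < t := by linarith
  have D := decays_add hc ha.hT₀ hp.decays
  have D₀ := decays_add hc ha.hT₀ hp₀.decays
  have hpd : 0 ≤ paramDist C P P₀ := by
    have := hc.C_nonneg
    unfold paramDist; positivity
  have hI : |tail (fun r => σ r + h r) t - tail (fun r => σ r + h₀ r) t| ≤ paramDist C P P₀ := by
    rw [← D.tail_sub D₀ ht]
    have hd : Decays (fun r => σ r + h r - (σ r + h₀ r)) T (paramDist C P P₀) 0 :=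
      ⟨hp.decays.pos, D.cont.sub D₀.cont, fun r hr => by
        simpa using hp.abs_sub_le hc ha ha₀ hp₀ hr⟩
    refine (hd.abs_tail_le ht).trans (div_le_self hpd ?_)
    simpa using ht1
  have b := (abs_le.1 (abs_tail_le_one hc ha hp.decays ht)).2
  have b₀ := (abs_le.1 (abs_tail_le_one hc ha₀ hp₀.decays ht)).2
  set I := tail (fun r => σ r + h r) t with hIdef
  set I₀ := tail (fun r => σ r + h₀ r) t with hI₀def
  have c1 : (m - P.1) * t + I ≤ 1 := by nlinarith [mul_nonneg (sub_nonneg.2 ha.hG) ht0.le]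
  have c2 : (m - P₀.1) * t + I₀ ≤ 1 := by nlinarith [mul_nonneg (sub_nonneg.2 ha₀.hG) ht0.le]
  have hX := abs_exp_sub_exp_le c1 c2
  have hX' : |(m - P.1) * t + I - ((m - P₀.1) * t + I₀)| ≤
      |P.1 - P₀.1| * t + paramDist C P P₀ := by
    rw [show (m - P.1) * t + I - ((m - P₀.1) * t + I₀) = -((P.1 - P₀.1) * t) + (I - I₀) by ring]
    refine (abs_add_le _ _).trans ?_
    rw [abs_neg, abs_mul, abs_of_pos ht0]
    gcongr
  have hr : 0 < t ^ (-(5 / 2) : ℝ) := Real.rpow_pos_of_pos ht0 _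
  have hr1 : t ^ (-(5 / 2) : ℝ) ≤ 1 := Real.rpow_le_one_of_one_le_of_nonpos ht1 (by norm_num)
  have key : endF σ m P h t - endF σ m P₀ h₀ t = t ^ (-(5 / 2) : ℝ) *
      (Real.exp ((m - P.1) * t + I) * (P.2 - P₀.2) +
        P₀.2 * (Real.exp ((m - P.1) * t + I) - Real.exp ((m - P₀.1) * t + I₀))) := by
    simp only [endF, ← hIdef, ← hI₀def, Real.exp_add]
    ring
  rw [key, abs_mul, abs_of_pos hr]
  refine (mul_le_of_le_one_left (abs_nonneg _) hr1).trans ((abs_add_le _ _).trans ?_)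
  rw [abs_mul, abs_mul, Real.abs_exp]
  gcongr
  exact hX.trans (by gcongr)

end

/-- The end solutions of a system `f' = -(φ + g) f`, `g' = -ψ g - f²` with
`φ = -ℓ⁻¹ + 5 / (2 t) + O(t⁻²)` and `ψ = O(t⁻³)`. -/
theorem exists_end_solutions {φ ψ : ℝ → ℝ} {ℓ C T₀ : ℝ} (hφ : ContDiffOn ℝ ∞ φ (Ioi 0))
    (hψ : ContDiffOn ℝ ∞ ψ (Ioi 0))
    (hc : EndCoeffs (fun t => φ t + ℓ⁻¹ - 5 / (2 * t)) ψ C T₀) :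
    ∃ (T : ℝ × ℝ → ℝ) (f g : ℝ × ℝ → ℝ → ℝ),
      (∀ P ∈ endParameters ℓ, 0 < T P ∧
        ContDiffOn ℝ ∞ (f P) (Ioi (T P)) ∧ ContDiffOn ℝ ∞ (g P) (Ioi (T P)) ∧
        SolvesOn φ ψ (T P) (f P) (g P) ∧ HasEndBehaviour ℓ P.1 P.2 (f P) (g P) ∧
        (∀ (T' : ℝ) (f' g' : ℝ → ℝ), SolvesOn φ ψ T' f' g' → HasEndBehaviour ℓ P.1 P.2 f' g' →
          ∀ t, max (T P) T' < t → f' t = f P t ∧ g' t = g P t)) ∧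
      (∀ P₀ ∈ endParameters ℓ, ∀ t₁ t₂ : ℝ, T P₀ < t₁ → t₁ ≤ t₂ →
        (∀ᶠ P in 𝓝[endParameters ℓ] P₀, T P < t₁) ∧
        TendstoUniformlyOn f (f P₀) (𝓝[endParameters ℓ] P₀) (Icc t₁ t₂) ∧
        TendstoUniformlyOn g (g P₀) (𝓝[endParameters ℓ] P₀) (Icc t₁ t₂)) := by
  set σ : ℝ → ℝ := fun t => φ t + ℓ⁻¹ - 5 / (2 * t) with hσ
  have hφσ : ∀ t, 0 < t → φ t = σ t - ℓ⁻¹ + 5 / (2 * t) := fun t _ => by simp only [hσ]; ring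
  have hC := hc.C_nonneg
  have hT₀ := hc.one_le
  set M : ℝ × ℝ → ℝ := fun P => C * |P.1| + 1 with hM
  set T : ℝ × ℝ → ℝ := fun P => T₀ + C + M P + 16 * P.2 ^ 2 with hT
  have hMpos : ∀ P, 1 ≤ M P := fun P => by
    have := mul_nonneg hC (abs_nonneg P.1)
    simp only [hM]; linarith
  have hadm : ∀ P ∈ endParameters ℓ, Admissible ℓ⁻¹ C T₀ (M P) (T P) P := fun P hP => by
    have := hMpos P
    have := sq_nonneg P.2
    exact ⟨hP.1, by simp only [hT]; linarith, le_rfl, by simp only [hT]; linarith,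
      by simp only [hT]; linarith⟩
  have hex : ∀ P, ∃ h, P ∈ endParameters ℓ → IsProfile σ ψ ℓ⁻¹ P (M P) (T P) h := fun P => by
    by_cases hP : P ∈ endParameters ℓ
    · obtain ⟨h, hh⟩ := exists_isProfile hc (hadm P hP)
      exact ⟨h, fun _ => hh⟩
    · exact ⟨0, fun h => absurd h hP⟩
  choose h hprof using hex
  have hTcont : Continuous T := by simp only [hT, hM]; fun_prop
  have hTpos : ∀ P, 0 < T P := fun P => by
    have := hMpos P
    have := sq_nonneg P.2
    simp only [hT]; linarith
  refine ⟨T, fun P => endF σ ℓ⁻¹ P (h P), fun P t => P.1 + h P t, fun P hP => ?_,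
    fun P₀ hP₀ t₁ t₂ ht₁ ht₁₂ => ?_⟩
  · have ha := hadm P hP
    have hp := hprof P hP
    have hsol := hp.solvesOn hφσ hc ha
    obtain ⟨cf, cg⟩ := hsol.contDiffOn (hTpos P).le hφ hψ
    refine ⟨hTpos P, cf, cg, hsol, hp.hasEndBehaviour hc ha, fun T' f' g' hs' he' t ht => ?_⟩
    obtain ⟨M₁, T₁, hp₁, hf₁⟩ := exists_isProfile_of_hasEndBehaviour hφσ hc hP.1 hs' he'
    -- Both profiles satisfy the same bounds from some later time on, so they agree there.
    set M₂ := max (M P) M₁ with hM₂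
    set T₂ := max (max (T P) T₁) (max (C + M₂) t) with hT₂
    have m1 : M P ≤ M₂ := le_max_left _ _
    have l1 : T P ≤ T₂ := (le_max_left _ _).trans (le_max_left _ _)
    have l2 : T₁ ≤ T₂ := (le_max_right _ _).trans (le_max_left _ _)
    have l3 : C + M₂ ≤ T₂ := (le_max_left _ _).trans (le_max_right _ _)
    have l4 : t ≤ T₂ := (le_max_right _ _).trans (le_max_right _ _)
    have ha₂ : Admissible ℓ⁻¹ C T₀ M₂ T₂ P :=
      ⟨ha.hG, ha.hT₀.trans l1, ha.hM.trans m1, l3, ha.hlam.trans l1⟩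
    have heq : ∀ s, T₂ ≤ s → g' s - P.1 = h P s := fun s hs => by
      have := (hp₁.mono (le_max_right _ _) l2).abs_sub_le hc ha₂ ha₂ (hp.mono m1 l1) hs
      simp only [paramDist, sub_self, abs_zero, mul_zero, add_zero, zero_div] at this
      exact sub_eq_zero.1 (abs_nonpos_iff.1 this)
    have hmax : 0 ≤ max (T P) T' := (hTpos P).le.trans (le_max_left _ _)
    refine (hs'.mono (le_max_right _ _)).eq_of_eq hmax hφ.continuousOn hψ.continuousOn
      (hsol.mono (le_max_left _ _)) (t₁ := T₂) ?_ ?_ ht l4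
    · rw [hf₁ T₂ l2]
      simp only [endF]
      congr 3
      exact tail_congr fun s hs => by rw [heq s hs.le]
    · linarith [heq T₂ le_rfl]
  · have hev : ∀ᶠ P in 𝓝[endParameters ℓ] P₀, T P < t₁ :=
      nhdsWithin_le_nhds ((hTcont.tendsto P₀).eventually (gt_mem_nhds ht₁))
    -- All nearby parameters are admissible with common constants on `[t₁, ∞)`.
    have hcommon : ∀ P ∈ endParameters ℓ, T P < t₁ →
        Admissible ℓ⁻¹ C T₀ (t₁ - C) t₁ P ∧ IsProfile σ ψ ℓ⁻¹ P (t₁ - C) t₁ (h P) := by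
      intro P hP hPt
      have h1 := hMpos P
      have h2 := sq_nonneg P.2
      have h3 : T₀ + C + M P + 16 * P.2 ^ 2 < t₁ := hPt
      exact ⟨⟨hP.1, by linarith, by simp only [hM] at h3; linarith, by linarith, by linarith⟩,
        (hprof P hP).mono (by linarith) hPt.le⟩
    have hpdc : Continuous fun P => paramDist C P P₀ := by unfold paramDist; fun_prop
    have hpd0 : paramDist C P₀ P₀ = 0 := by simp [paramDist]
    obtain ⟨ha₀, hp₀⟩ := hcommon P₀ hP₀ ht₁
    have ht₁1 : 1 ≤ t₁ := ha₀.one_le_T hc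
    refine ⟨hev, ?_, ?_⟩
    · rw [Metric.tendstoUniformlyOn_iff]
      intro ε hε
      have hB : Continuous fun P : ℝ × ℝ => Real.exp 1 * |P.2 - P₀.2| +
          |P₀.2| * (Real.exp 1 * (|P.1 - P₀.1| * t₂ + paramDist C P P₀)) := by fun_prop
      have hBε := (hB.tendsto P₀).eventually_lt_const (u := ε) (by simpa [hpd0] using hε)
      filter_upwards [hev, nhdsWithin_le_nhds hBε, self_mem_nhdsWithin] with P h1 h2 hP t ht
      obtain ⟨ha, hp⟩ := hcommon P hP h1
      rw [dist_comm, Real.dist_eq]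
      refine (abs_endF_sub_le hc ha ha₀ hp hp₀ ht.1).trans_lt (lt_of_le_of_lt ?_ h2)
      gcongr
      exact ht.2
    · rw [Metric.tendstoUniformlyOn_iff]
      intro ε hε
      have hB : Continuous fun P : ℝ × ℝ => |P.1 - P₀.1| + paramDist C P P₀ := by fun_prop
      have hBε := (hB.tendsto P₀).eventually_lt_const (u := ε) (by simpa [hpd0] using hε)
      filter_upwards [hev, nhdsWithin_le_nhds hBε, self_mem_nhdsWithin] with P h1 h2 hP t ht
      obtain ⟨ha, hp⟩ := hcommon P hP h1
      have ht1 : 1 ≤ t := ht₁1.trans ht.1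
      have hb := hp.abs_sub_le hc ha ha₀ hp₀ ht.1
      have hpd : 0 ≤ paramDist C P P₀ := by unfold paramDist; positivity
      have hb' := hb.trans (div_le_self hpd (one_le_pow₀ ht1))
      rw [dist_comm, Real.dist_eq, add_sub_add_comm]
      exact ((abs_add_le _ _).trans (by gcongr)).trans_lt h2


/-! ### The Hitchin flow as a first order system -/

/-- The quantity `D = √(4 a² - (b + p)²)`; for `q = -p` the potential is `((b - p) D)²`. -/
noncomputable def disc (p : ℝ) (a b : ℝ → ℝ) (t : ℝ) : ℝ := √(4 * a t ^ 2 - (b t + p) ^ 2)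

/-- The Hitchin flow with `q = -p` as an autonomous first order system for `a`, `b` and `u = a'`.
The equation for `b` is the Hamiltonian constraint `2 (a')² b' = (b - p) D`. -/
structure ReducedFlow (p : ℝ) (a b u : ℝ → ℝ) : Prop where
  p_pos : 0 < p
  u_pos : ∀ t, 0 < t → 0 < u t
  p_lt_b : ∀ t, 0 < t → p < b t
  b_lt_a : ∀ t, 0 < t → b t < a t
  hasDerivAt_a : ∀ t, 0 < t → HasDerivAt a (u t) t
  hasDerivAt_b : ∀ t, 0 < t → HasDerivAt b ((b t - p) * disc p a b t / (2 * u t ^ 2)) t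
  hasDerivAt_u : ∀ t, 0 < t →
    HasDerivAt u ((2 * a t ^ 2 - b t * (b t + p)) / (disc p a b t * u t)) t

lemma hasDerivAt_potential_fst (p q a b : ℝ) :
    HasDerivAt (fun y => potential p q y b) (8 * a * (b - p) * (b + q)) a := by
  have h := ((((hasDerivAt_id a).pow 2).const_mul 4).mul_const (b - p)).mul_const (b + q)
  refine (h.sub_const ((b ^ 2 + p * q) ^ 2)).congr_deriv ?_
  simp only [id, Nat.add_one_sub_one, pow_one]
  push_cast
  ring

lemma hasDerivAt_potential_snd (p q a b : ℝ) :
    HasDerivAt (fun y => potential p q a y)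
      (4 * a ^ 2 * (2 * b - p + q) - 4 * b * (b ^ 2 + p * q)) b := by
  have h1 := ((hasDerivAt_id b).sub_const p).const_mul (4 * a ^ 2)
  have h2 := h1.mul ((hasDerivAt_id b).add_const q)
  have h3 := (((hasDerivAt_id b).pow 2).add_const (p * q)).pow 2
  refine (h2.sub h3).congr_deriv ?_
  simp; ring

lemma hasDerivAt_potential {p q a' b' t : ℝ} {a b : ℝ → ℝ} (ha : HasDerivAt a a' t)
    (hb : HasDerivAt b b' t) :
    HasDerivAt (fun s => potential p q (a s) (b s))
      (8 * a t * (b t - p) * (b t + q) * a' +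
        (4 * a t ^ 2 * (2 * b t - p + q) - 4 * b t * (b t ^ 2 + p * q)) * b') t := by
  have h := ((((ha.pow 2).const_mul 4).mul (hb.sub_const p)).mul (hb.add_const q)).sub
    (((hb.pow 2).add_const (p * q)).pow 2)
  refine h.congr_deriv ?_
  simp; ring

lemma potential_neg (p a b : ℝ) :
    potential p (-p) a b = (b - p) ^ 2 * (4 * a ^ 2 - (b + p) ^ 2) := by
  unfold potential; ring

section Monotone

variable {N N' : ℝ → ℝ} {T c : ℝ}

lemma le_of_deriv_nonneg_of_tendsto (hN : ∀ t ∈ Ioo 0 T, HasDerivAt N (N' t) t)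
    (h0 : ∀ t ∈ Ioo 0 T, 0 ≤ N' t) (hlim : Tendsto N (𝓝[>] 0) (𝓝 c)) {t : ℝ}
    (ht : t ∈ Ioo 0 T) : c ≤ N t := by
  have hmono : MonotoneOn N (Ioo 0 T) := by
    refine monotoneOn_of_deriv_nonneg (convex_Ioo _ _)
      (fun s hs => (hN s hs).continuousAt.continuousWithinAt) (fun s hs => ?_) fun s hs => ?_
    · exact (hN s (interior_subset hs)).differentiableAt.differentiableWithinAt
    · rw [(hN s (interior_subset hs)).deriv]
      exact h0 s (interior_subset hs)
  refine le_of_tendsto hlim ?_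
  filter_upwards [Ioo_mem_nhdsGT ht.1] with s hs
  exact hmono ⟨hs.1, hs.2.trans ht.2⟩ ht hs.2.le

lemma lt_of_deriv_pos_of_tendsto (hN : ∀ t ∈ Ioo 0 T, HasDerivAt N (N' t) t)
    (h0 : ∀ t ∈ Ioo 0 T, 0 < N' t) (hlim : Tendsto N (𝓝[>] 0) (𝓝 c)) {t : ℝ}
    (ht : t ∈ Ioo 0 T) : c < N t := by
  have hmono : StrictMonoOn N (Ioo 0 T) := by
    refine strictMonoOn_of_deriv_pos (convex_Ioo _ _)
      (fun s hs => (hN s hs).continuousAt.continuousWithinAt) fun s hs => ?_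
    rw [(hN s (interior_subset hs)).deriv]
    exact h0 s (interior_subset hs)
  have h2 : t / 2 ∈ Ioo 0 T := ⟨by linarith [ht.1], by linarith [ht.1, ht.2]⟩
  exact (le_of_deriv_nonneg_of_tendsto hN (fun s hs => (h0 s hs).le) hlim h2).trans_lt
    (hmono h2 ht (by linarith [ht.1]))

lemma eq_of_deriv_zero_of_tendsto (hN : ∀ t, 0 < t → HasDerivAt N 0 t)
    (hlim : Tendsto N (𝓝[>] 0) (𝓝 c)) {t : ℝ} (ht : 0 < t) : N t = c := by
  have hmem : t ∈ Ioo 0 (t + 1) := ⟨ht, by linarith⟩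
  have h1 := le_of_deriv_nonneg_of_tendsto (N' := fun _ => 0) (fun s hs => hN s hs.1)
    (fun _ _ => le_rfl) hlim hmem
  have h2 := le_of_deriv_nonneg_of_tendsto (N := fun s => -N s) (N' := fun _ => -0)
    (fun s hs => (hN s hs.1).neg) (fun _ _ => by simp) hlim.neg hmem
  linarith

/-- If `w` starts at `0` with positive values and its derivative is positive as long as `w` is,
then `w` stays positive. -/
lemma pos_of_deriv_pos_of_pos {w w' : ℝ → ℝ} (hw : ∀ t, 0 < t → HasDerivAt w (w' t) t)
    (hev : ∀ᶠ t in 𝓝[>] 0, 0 < w t)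
    (hstep : ∀ T, 0 < T → (∀ t ∈ Ioo 0 T, 0 < w t) → ∀ t ∈ Ioo 0 T, 0 < w' t) {t : ℝ}
    (ht : 0 < t) : 0 < w t := by
  by_contra hneg
  obtain ⟨ε, hε, hpos⟩ := mem_nhdsGT_iff_exists_Ioo_subset.1 hev
  have hε : 0 < ε := hε
  have hcont : ContinuousOn w (Icc (ε / 2) t) := fun s hs =>
    (hw s (by linarith [hs.1])).continuousAt.continuousWithinAt
  have htε : ε / 2 ≤ t := by
    by_contra hlt
    exact hneg (hpos ⟨ht, by linarith⟩)
  have hcomp : IsCompact (Icc (ε / 2) t ∩ w ⁻¹' Iic 0) :=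
    isCompact_Icc.of_isClosed_subset (hcont.preimage_isClosed_of_isClosed isClosed_Icc isClosed_Iic)
      inter_subset_left
  obtain ⟨t₀, ⟨ht₀, hwt₀⟩, hleast⟩ := hcomp.exists_isLeast ⟨t, ⟨⟨htε, le_rfl⟩, not_lt.1 hneg⟩⟩
  have ht₀0 : 0 < t₀ := by linarith [ht₀.1]
  have hbefore : ∀ s ∈ Ioo 0 t₀, 0 < w s := by
    intro s hs
    by_contra hs'
    by_cases hsε : s < ε
    · exact hs' (hpos ⟨hs.1, hsε⟩)
    · exact absurd (hleast ⟨⟨by linarith, hs.2.le.trans ht₀.2⟩, not_lt.1 hs'⟩) (not_le.2 hs.2)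
  have hder := hstep t₀ ht₀0 hbefore
  have hmono : StrictMonoOn w (Icc (t₀ / 2) t₀) := by
    refine strictMonoOn_of_deriv_pos (convex_Icc _ _)
      (fun s hs => (hw s (by linarith [hs.1])).continuousAt.continuousWithinAt) fun s hs => ?_
    rw [interior_Icc] at hs
    have hs0 : 0 < s := by linarith [hs.1]
    rw [(hw s hs0).deriv]
    exact hder s ⟨hs0, hs.2⟩
  have h1 := hmono ⟨le_rfl, by linarith⟩ ⟨by linarith, le_rfl⟩ (by linarith : t₀ / 2 < t₀)
  have h2 := hbefore (t₀ / 2) ⟨by linarith, by linarith⟩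
  exact absurd hwt₀ (not_le.2 (h2.trans h1))

end Monotone

lemma eventually_pos_of_isLittleO {f : ℝ → ℝ} {c : ℝ} {k : ℕ} (hc : 0 < c)
    (h : (fun t => f t - c * t ^ k) =o[𝓝[>] 0] fun t => t ^ k) : ∀ᶠ t in 𝓝[>] 0, 0 < f t := by
  filter_upwards [h.def (half_pos hc), self_mem_nhdsWithin] with t ht ht0
  have ht0 : 0 < t := ht0
  have hk : 0 < t ^ k := pow_pos ht0 k
  rw [Real.norm_eq_abs, Real.norm_eq_abs, abs_of_pos hk, abs_le] at ht
  nlinarith [mul_pos hc hk]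

lemma isLittleO_pow_nhdsGT {m n : ℕ} (h : m < n) :
    (fun t : ℝ => t ^ n) =o[𝓝[>] 0] fun t => t ^ m :=
  (isLittleO_pow_pow h).mono nhdsWithin_le_nhds

/-- The behaviour at `0⁺` of a function with an even expansion `r + c t² + d t⁴ + O(t⁶)`. -/
lemma initial_of_expansion {y : ℝ → ℝ} {r c d : ℝ} (hy : ContDiffOn ℝ ∞ y (Ici 0))
    (he : (fun t => y t - (r + c * t ^ 2 + d * t ^ 4)) =O[𝓝[>] 0] fun t => t ^ 6) :
    y 0 = r ∧ Tendsto y (𝓝[>] 0) (𝓝 r) ∧ Tendsto (deriv y) (𝓝[>] 0) (𝓝 0) ∧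
      (fun t => y t - r - c * t ^ 2) =o[𝓝[>] 0] fun t => t ^ 2 := by
  have h2 : (fun t => y t - r - c * t ^ 2) =o[𝓝[>] 0] fun t => t ^ 2 := by
    have h4 : (fun t : ℝ => d * t ^ 4) =o[𝓝[>] 0] fun t => t ^ 2 :=
      (isLittleO_pow_nhdsGT (by norm_num)).const_mul_left d
    refine ((he.trans_isLittleO (isLittleO_pow_nhdsGT (by norm_num : 2 < 6))).add h4).congr_left
      fun t => ?_
    ring
  have hO : (fun t => y t - r) =o[𝓝[>] 0] fun t => t := by
    have h1 : (fun t : ℝ => t ^ 2) =o[𝓝[>] 0] fun t => t := by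
      simpa using isLittleO_pow_nhdsGT (by norm_num : 1 < 2)
    refine ((h2.trans h1).add (h1.const_mul_left c)).congr_left fun t => ?_
    ring
  have hid : Tendsto (fun t : ℝ => t) (𝓝[>] 0) (𝓝 0) := tendsto_id.mono_left nhdsWithin_le_nhds
  have hlim : Tendsto y (𝓝[>] 0) (𝓝 r) := by
    have := (hO.isBigO.trans_tendsto hid).add_const r
    simpa using this
  have hcont : Tendsto y (𝓝[>] 0) (𝓝 (y 0)) :=
    (hy.continuousOn 0 self_mem_Ici).mono_left (nhdsWithin_mono _ Ioi_subset_Ici_self)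
  have hy0 : y 0 = r := tendsto_nhds_unique hcont hlim
  refine ⟨hy0, hlim, ?_, h2⟩
  have hd : HasDerivWithinAt y 0 (Ici 0) 0 := by
    rw [← hasDerivWithinAt_Ioi_iff_Ici, hasDerivWithinAt_iff_isLittleO]
    simpa [hy0] using hO
  have hdc : ContinuousOn (derivWithin y (Ici 0)) (Ici 0) :=
    hy.continuousOn_derivWithin (uniqueDiffOn_Ici 0) (by simp)
  have h0 : Tendsto (derivWithin y (Ici 0)) (𝓝[>] 0) (𝓝 0) := by
    have := (hdc 0 self_mem_Ici).mono_left (nhdsWithin_mono _ Ioi_subset_Ici_self)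
    rwa [hd.derivWithin (uniqueDiffOn_Ici (0 : ℝ) 0 self_mem_Ici)] at this
  refine h0.congr' ?_
  filter_upwards [self_mem_nhdsWithin] with t ht
  exact derivWithin_of_mem_nhds (Ici_mem_nhds ht)

lemma contDiffOn_deriv_Ioi {y : ℝ → ℝ} (hy : ContDiffOn ℝ ∞ y (Ici 0)) :
    ContDiffOn ℝ ∞ (deriv y) (Ioi 0) :=
  ((contDiffOn_infty_iff_deriv_of_isOpen isOpen_Ioi).1 (hy.mono Ioi_subset_Ici_self)).2

/-- The members of the `𝔹₇`-family solve the first order system. -/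
theorem IsB7Member.reducedFlow {r₀ abar bbar : ℝ} {a b : ℝ → ℝ}
    (hab : IsB7Member r₀ abar bbar a b) : ReducedFlow (r₀ ^ 3) a b (deriv a) := by
  have hr := hab.r₀_pos
  have hp : 0 < r₀ ^ 3 := by positivity
  obtain ⟨a0, alim, ualim, aexp⟩ := initial_of_expansion hab.contDiffOn_a hab.expansion_a
  obtain ⟨b0, blim, ublim, -⟩ := initial_of_expansion hab.contDiffOn_b hab.expansion_b
  have hwexp : (fun t => (a t - b t) - (abar - bbar) * t ^ 4) =o[𝓝[>] 0] fun t => t ^ 4 := by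
    refine ((hab.expansion_a.sub hab.expansion_b).trans_isLittleO
      (isLittleO_pow_nhdsGT (by norm_num))).congr_left fun t => ?_
    ring
  have hwpos := eventually_pos_of_isLittleO (sub_pos.2 hab.bbar_lt_abar) hwexp
  have hapos := eventually_pos_of_isLittleO (by positivity : 0 < r₀ / 4) aexp
  set p := r₀ ^ 3 with hpdef
  have F := hab.flow
  have hvol := F.volume_pos
  have hx0 : ∀ t, 0 < t → deriv a t ≠ 0 ∧ deriv b t ≠ 0 := fun t ht => by
    have := hvol t ht
    constructor <;> rintro h <;> simp [h] at this
  have hda : ∀ t, 0 < t → HasDerivAt a (deriv a t) t := fun t ht =>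
    (F.hasDerivAt_y₁ t ht).differentiableAt.hasDerivAt
  have hdb : ∀ t, 0 < t → HasDerivAt b (deriv b t) t := fun t ht =>
    (F.hasDerivAt_y₂ t ht).differentiableAt.hasDerivAt
  have hbpos : ∀ t, 0 < t → 0 < deriv b t := fun t ht => by
    obtain ⟨h1, h2⟩ := hx0 t ht
    rw [(F.hasDerivAt_y₂ t ht).deriv]
    have := Real.sqrt_pos.2 (hvol t ht)
    positivity
  have hcu := (contDiffOn_deriv_Ioi hab.contDiffOn_a).continuousOn
  have hupos : ∀ t, 0 < t → 0 < deriv a t := by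
    -- A negative value would force `a` to decrease, against its expansion at `0`.
    by_contra! hneg
    obtain ⟨t₀, ht₀, hle⟩ := hneg
    have hall : ∀ t, 0 < t → deriv a t < 0 := by
      intro t ht
      by_contra! hge
      obtain ⟨s, hs, hs0⟩ := isPreconnected_Ioi.intermediate_value (mem_Ioi.2 ht₀) (mem_Ioi.2 ht)
        hcu ⟨hle, hge⟩
      exact (hx0 s hs).1 hs0
    have hanti : StrictAntiOn a (Ici 0) := by
      refine strictAntiOn_of_deriv_neg (convex_Ici 0) hab.contDiffOn_a.continuousOn fun s hs => ?_
      rw [interior_Ici] at hs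
      exact hall s hs
    obtain ⟨s, hs1, hs2⟩ := (hapos.and self_mem_nhdsWithin).exists
    have hs2 : 0 < s := hs2
    have := hanti self_mem_Ici (mem_Ici.2 hs2.le) hs2
    rw [a0] at this
    linarith
  have hb : ∀ t, 0 < t → p < b t := fun t ht => by
    have hmono : StrictMonoOn b (Ici 0) := by
      refine strictMonoOn_of_deriv_pos (convex_Ici 0) hab.contDiffOn_b.continuousOn fun s hs => ?_
      rw [interior_Ici] at hs
      exact hbpos s hs
    have := hmono self_mem_Ici (mem_Ici.2 ht.le) ht
    rwa [b0] at this
  have hdisc : ∀ t, 0 < t → 0 < 4 * a t ^ 2 - (b t + p) ^ 2 := fun t ht => by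
    have h1 := F.potential_pos t ht
    rw [potential_neg] at h1
    exact pos_of_mul_pos_right h1 (sq_nonneg _)
  have hD : ∀ t, 0 < t → 0 < disc p a b t := fun t ht => Real.sqrt_pos.2 (hdisc t ht)
  have hsqrtF : ∀ t, 0 < t → √(potential p (-p) (a t) (b t)) = (b t - p) * disc p a b t :=
    fun t ht => by
      rw [potential_neg, Real.sqrt_mul (sq_nonneg _), Real.sqrt_sq (sub_pos.2 (hb t ht)).le, disc]
  have hsqrtV : ∀ t, 0 < t →
      √((deriv a t * deriv b t) ^ 2 * (deriv a t) ^ 2) = deriv a t ^ 2 * deriv b t := fun t ht => by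
    have h1 := hupos t ht
    have h2 := hbpos t ht
    rw [← mul_pow, Real.sqrt_sq (by positivity)]
    ring
  have hx₁ : ∀ t, 0 < t → HasDerivAt (fun s => deriv a s * deriv b s)
      (2 * a t * (b t - p) / disc p a b t) t := fun t ht => by
    refine (F.hasDerivAt_x₁ t ht).congr_deriv ?_
    have h1 := sub_pos.2 (hb t ht)
    have h2 := hD t ht
    rw [hsqrtF t ht, (hasDerivAt_potential_fst _ _ _ _).deriv]
    field_simp
    ring
  have hx₂ : ∀ t, 0 < t → HasDerivAt (fun s => deriv a s ^ 2)
      (2 * (2 * a t ^ 2 - b t * (b t + p)) / disc p a b t) t := fun t ht => by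
    refine (F.hasDerivAt_x₂ t ht).congr_deriv ?_
    have h1 := sub_pos.2 (hb t ht)
    have h2 := hD t ht
    rw [hsqrtF t ht, (hasDerivAt_potential_snd _ _ _ _).deriv]
    field_simp
    ring
  -- The Hamiltonian constraint: the difference is conserved and vanishes at the singular orbit.
  have hHam : ∀ t, 0 < t → 2 * (deriv a t ^ 2 * deriv b t) = (b t - p) * disc p a b t := by
    intro t ht
    have hder : ∀ s, 0 < s → HasDerivAt
        (fun s => 2 * √((deriv a s * deriv b s) ^ 2 * (deriv a s) ^ 2) -
          √(potential p (-p) (a s) (b s))) 0 s := by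
      intro s hs
      have h1 := hupos s hs
      have h2 := hbpos s hs
      have h3 := sub_pos.2 (hb s hs)
      have h4 := hD s hs
      have e1 := ((((hx₁ s hs).pow 2).mul (hx₂ s hs)).sqrt (hvol s hs).ne').const_mul 2
      have e2 := (hasDerivAt_potential (p := p) (q := -p) (hda s hs) (hdb s hs)).sqrt
        (F.potential_pos s hs).ne'
      refine (e1.sub e2).congr_deriv ?_
      simp only [Pi.mul_apply, Pi.pow_apply]
      rw [hsqrtF s hs, hsqrtV s hs]
      field_simp
      ring
    have hcb : Tendsto (deriv b) (𝓝[>] 0) (𝓝 0) := ublim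
    have hlim : Tendsto (fun s => 2 * √((deriv a s * deriv b s) ^ 2 * (deriv a s) ^ 2) -
          √(potential p (-p) (a s) (b s))) (𝓝[>] 0) (𝓝 0) := by
      have l1 := (((((ualim.mul hcb).pow 2).mul (ualim.pow 2)).sqrt).const_mul 2)
      have l2 : Tendsto (fun s => √(potential p (-p) (a s) (b s))) (𝓝[>] 0)
          (𝓝 (√(potential p (-p) p p))) := by
        refine Tendsto.sqrt ?_
        unfold potential
        exact ((((alim.pow 2).const_mul 4).mul (blim.sub_const p)).mul (blim.add_const (-p))).sub
          (((blim.pow 2).add_const _).pow 2)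
      simpa [potential_neg] using l1.sub l2
    have := eq_of_deriv_zero_of_tendsto hder hlim ht
    rw [hsqrtF t ht, hsqrtV t ht] at this
    linarith
  refine ⟨hp, hupos, hb, fun t ht => ?_, hda, fun t ht => ?_, fun t ht => ?_⟩
  · -- `w = a - b` satisfies `(a' w')' = w (4 a + 2 b + 2 p) / D`.
    rw [← sub_pos]
    refine pos_of_deriv_pos_of_pos (w := fun t => a t - b t)
      (fun t ht => (hda t ht).sub (hdb t ht)) hwpos (fun T hT hwT t ht => ?_) ht
    have hy : ∀ s ∈ Ioo 0 T, HasDerivAt (fun s => deriv a s ^ 2 - deriv a s * deriv b s)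
        ((a s - b s) * (4 * a s + 2 * b s + 2 * p) / disc p a b s) s := fun s hs => by
      refine ((hx₂ s hs.1).sub (hx₁ s hs.1)).congr_deriv ?_
      have := hD s hs.1
      field_simp
      ring
    have hylim : Tendsto (fun s => deriv a s ^ 2 - deriv a s * deriv b s) (𝓝[>] 0) (𝓝 0) := by
      simpa using (ualim.pow 2).sub (ualim.mul ublim)
    have hypos := lt_of_deriv_pos_of_tendsto hy (fun s hs => by
      have h1 := hwT s hs
      have h2 := hb s hs.1
      have h3 : 0 < a s := by linarith
      have h4 : 0 < b s := by linarith
      have h5 := hD s hs.1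
      positivity) hylim ht
    have h1 := hupos t ht.1
    have h2 : 0 < deriv a t * (deriv a t - deriv b t) := by linarith
    exact pos_of_mul_pos_right h2 h1.le
  · refine (hdb t ht).congr_deriv ?_
    have h1 := hupos t ht
    rw [eq_div_iff (by positivity), ← hHam t ht]
    ring
  · have h1 := hupos t ht
    have h2 := hD t ht
    have h3 := (hx₂ t ht).sqrt (by positivity)
    rw [Real.sqrt_sq h1.le] at h3
    refine (h3.congr_of_eventuallyEq ?_).congr_deriv ?_
    · filter_upwards [Ioi_mem_nhds ht] with s hs
      rw [Real.sqrt_sq (hupos s hs).le]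
    · field_simp


/-! ### Asymptotics of the metric -/

lemma monotoneOn_Ici_of_hasDerivAt {N N' : ℝ → ℝ} {T : ℝ} (hN : ∀ t, T ≤ t → HasDerivAt N (N' t) t)
    (h0 : ∀ t, T ≤ t → 0 ≤ N' t) : MonotoneOn N (Ici T) := by
  refine monotoneOn_of_deriv_nonneg (convex_Ici T)
    (fun s hs => (hN s hs).continuousAt.continuousWithinAt) (fun s hs => ?_) fun s hs => ?_
  · exact (hN s (interior_subset hs)).differentiableAt.differentiableWithinAt
  · rw [(hN s (interior_subset hs)).deriv]
    exact h0 s (interior_subset hs)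

/-- The coefficient of `f` in the reduced equations. -/
noncomputable def fCoeff (p : ℝ) (a b u : ℝ → ℝ) (t : ℝ) : ℝ :=
  2 * a t * u t / disc p a b t ^ 2 + disc p a b t / (4 * u t ^ 2) -
    (b t - p) * disc p a b t / (4 * u t ^ 2 * (2 * a t - (b t + p))) - u t / (b t - p)

/-- The coefficient of `g` in the reduced equations. -/
noncomputable def gCoeff (p : ℝ) (a b u : ℝ → ℝ) (t : ℝ) : ℝ :=
  -((b t - p) * (b t + p) / (2 * u t ^ 2 * disc p a b t))

section Pointwise

variable {p : ℝ} {a b u : ℝ → ℝ} {t : ℝ}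

namespace ReducedFlow

lemma b_pos (R : ReducedFlow p a b u) (ht : 0 < t) : 0 < b t := R.p_pos.trans (R.p_lt_b t ht)

lemma a_pos (R : ReducedFlow p a b u) (ht : 0 < t) : 0 < a t := (R.b_pos ht).trans (R.b_lt_a t ht)

lemma add_lt_two_mul (R : ReducedFlow p a b u) (ht : 0 < t) : b t + p < 2 * a t := by
  linarith [R.p_lt_b t ht, R.b_lt_a t ht]

lemma radicand_pos (R : ReducedFlow p a b u) (ht : 0 < t) : 0 < 4 * a t ^ 2 - (b t + p) ^ 2 := by
  have h1 := R.add_lt_two_mul ht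
  have h2 := R.b_pos ht
  nlinarith [R.p_pos]

lemma disc_pos (R : ReducedFlow p a b u) (ht : 0 < t) : 0 < disc p a b t :=
  Real.sqrt_pos.2 (R.radicand_pos ht)

lemma disc_sq (R : ReducedFlow p a b u) (ht : 0 < t) :
    disc p a b t ^ 2 = 4 * a t ^ 2 - (b t + p) ^ 2 := Real.sq_sqrt (R.radicand_pos ht).le

lemma disc_le (R : ReducedFlow p a b u) (ht : 0 < t) : disc p a b t ≤ 2 * a t := by
  have h1 := R.disc_sq ht
  have h2 := R.a_pos ht
  exact abs_le_of_sq_le_sq' (by nlinarith [sq_nonneg (b t + p)]) (by linarith) |>.2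

lemma accel_pos (R : ReducedFlow p a b u) (ht : 0 < t) :
    0 < (2 * a t ^ 2 - b t * (b t + p)) / (disc p a b t * u t) := by
  have h1 := R.p_lt_b t ht
  have h2 := R.b_lt_a t ht
  have h3 := R.b_pos ht
  have h4 := R.disc_pos ht
  have h5 := R.u_pos t ht
  have h6 : b t * (b t + p) < b t * (2 * b t) := by gcongr; linarith
  have h7 : b t ^ 2 < a t ^ 2 := by gcongr
  have h8 : 0 < 2 * a t ^ 2 - b t * (b t + p) := by nlinarith
  positivity

lemma le_disc (R : ReducedFlow p a b u) (ht : 0 < t) (hs : b t + p ≤ a t) : a t ≤ disc p a b t := by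
  have h1 := R.disc_sq ht
  have h2 := R.a_pos ht
  have h3 := R.b_pos ht
  have h4 := R.p_pos
  refine abs_le_of_sq_le_sq' ?_ (R.disc_pos ht).le |>.2
  nlinarith [mul_self_le_mul_self (by linarith : 0 ≤ b t + p) hs]

/-- On the end `(u²)' / 2 = (2 a² - b (b + p)) / D` is close to `a`. -/
lemma abs_accel_sub_le (R : ReducedFlow p a b u) (ht : 0 < t) (hs : b t + p ≤ a t) :
    |(2 * a t ^ 2 - b t * (b t + p)) / disc p a b t - a t| ≤ (b t + p) ^ 2 / a t := by
  have h1 := R.disc_sq ht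
  have h2 := R.a_pos ht
  have h3 := R.b_pos ht
  have h4 := R.p_pos
  have h5 := R.disc_pos ht
  have h6 := R.disc_le ht
  have h7 := R.le_disc ht hs
  set D := disc p a b t
  have e1 : (2 * a t - D) * (2 * a t + D) = (b t + p) ^ 2 := by linear_combination -h1
  have e2 : a t * (2 * a t - D) ≤ (b t + p) ^ 2 := by
    rw [← e1, mul_comm]
    gcongr
    linarith
  have e3 : 0 ≤ a t * (2 * a t - D) := mul_nonneg h2.le (by linarith)
  have e4 : 0 ≤ b t * (b t + p) := by positivity
  have e5 : b t * (b t + p) ≤ (b t + p) ^ 2 := by nlinarith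
  have e6 : (2 * a t ^ 2 - b t * (b t + p)) / D - a t =
      (a t * (2 * a t - D) - b t * (b t + p)) / D := by
    field_simp
    ring
  rw [e6, abs_div, abs_of_pos h5]
  gcongr
  rw [abs_le]
  constructor <;> linarith

/-- The coefficient `A₃ = (b - p) / u` is increasing. -/
lemma hasDerivAt_ratio (R : ReducedFlow p a b u) (ht : 0 < t) :
    HasDerivAt (fun t => (b t - p) / u t)
      ((b t - p) ^ 2 * (b t + p) / (2 * u t ^ 3 * disc p a b t)) t := by
  have h1 := R.u_pos t ht
  have h2 := R.disc_pos ht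
  have h3 := R.disc_sq ht
  refine (((R.hasDerivAt_b t ht).sub_const p).div (R.hasDerivAt_u t ht) h1.ne').congr_deriv ?_
  field_simp
  rw [h3]
  ring

end ReducedFlow

end Pointwise

section Asymptotic

variable {p ℓ : ℝ} {a b u : ℝ → ℝ}

namespace ReducedFlow

lemma tendsto_a (R : ReducedFlow p a b u) : Tendsto a atTop atTop := by
  have hu : MonotoneOn u (Ici 1) := monotoneOn_Ici_of_hasDerivAt
    (fun t ht => R.hasDerivAt_u t (by linarith)) fun t ht => (R.accel_pos (by linarith)).le
  have h1 : MonotoneOn (fun t => a t - u 1 * t) (Ici 1) := monotoneOn_Ici_of_hasDerivAt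
    (fun t ht => (R.hasDerivAt_a t (by linarith)).sub ((hasDerivAt_id t).const_mul (u 1)))
    fun t ht => by
      have := hu self_mem_Ici (mem_Ici.2 ht) ht
      linarith
  have h2 : Tendsto (fun t => (a 1 - u 1 * 1) + u 1 * t) atTop atTop :=
    tendsto_atTop_add_const_left _ _ (tendsto_id.const_mul_atTop (R.u_pos 1 one_pos))
  refine tendsto_atTop_mono' _ ?_ h2
  filter_upwards [eventually_ge_atTop 1] with t ht
  have := h1 self_mem_Ici (mem_Ici.2 ht) ht
  simp only at this
  linarith

lemma eventually_b_le (R : ReducedFlow p a b u) (hℓ : IsAsymptoticCircleLength a b ℓ) :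
    ∃ c, 1 ≤ c ∧ ∀ᶠ t in atTop, b t + p ≤ c * (a t ^ (1 / 3 : ℝ)) ^ 2 := by
  refine ⟨4 * (|ℓ| + 1), by linarith [abs_nonneg ℓ], ?_⟩
  have h1 : ∀ᶠ t in atTop, (2 * b t ^ 3 / (3 * a t ^ 2)) ^ (1 / 3 : ℝ) < |ℓ| + 1 :=
    Tendsto.eventually_lt_const (by linarith [le_abs_self ℓ]) hℓ
  filter_upwards [h1, eventually_gt_atTop 0] with t ht ht0
  have hb := R.b_pos ht0
  have ha := R.a_pos ht0
  set L := |ℓ| + 1 with hL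
  have hL0 : 0 < L := by positivity
  set n := a t ^ (1 / 3 : ℝ) with hn
  have hn0 : 0 < n := Real.rpow_pos_of_pos ha _
  have hn3 : n ^ 3 = a t := by
    rw [hn, ← Real.rpow_natCast, ← Real.rpow_mul ha.le]; norm_num
  have h2 : 2 * b t ^ 3 / (3 * a t ^ 2) ≤ L ^ 3 := by
    have h3 : ((2 * b t ^ 3 / (3 * a t ^ 2)) ^ (1 / 3 : ℝ)) ^ 3 = 2 * b t ^ 3 / (3 * a t ^ 2) := by
      rw [← Real.rpow_natCast, ← Real.rpow_mul (by positivity)]; norm_num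
    rw [← h3]
    gcongr
  rw [div_le_iff₀ (by positivity), ← hn3] at h2
  have h4 : b t ≤ 2 * L * n ^ 2 := by
    refine le_of_pow_le_pow_left₀ (n := 3) (by norm_num) (by positivity) ?_
    have : 0 ≤ L ^ 3 * n ^ 6 := by positivity
    nlinarith
  linarith [R.p_lt_b t ht0]

lemma hasDerivAt_cbrt (R : ReducedFlow p a b u) {t : ℝ} (ht : 0 < t) :
    HasDerivAt (fun t => a t ^ (1 / 3 : ℝ)) (u t / (3 * (a t ^ (1 / 3 : ℝ)) ^ 2)) t := by
  have ha := R.a_pos ht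
  refine ((R.hasDerivAt_a t ht).rpow_const (Or.inl ha.ne')).congr_deriv ?_
  rw [Real.rpow_sub_one ha.ne']
  have hn0 : 0 < a t ^ (1 / 3 : ℝ) := Real.rpow_pos_of_pos ha _
  have hn3 : (a t ^ (1 / 3 : ℝ)) ^ 3 = a t := by
    rw [← Real.rpow_natCast, ← Real.rpow_mul ha.le]; norm_num
  have h1 : a t ^ (1 / 3 : ℝ) / a t = 1 / (a t ^ (1 / 3 : ℝ)) ^ 2 := by
    rw [div_eq_div_iff ha.ne' (by positivity), ← pow_succ', hn3, one_mul]
  rw [h1]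
  field_simp

/-- `u³ = (3/2) a² + O(a^{4/3})`: both sides have almost the same derivative. -/
lemma exists_abs_cube_sub_le (R : ReducedFlow p a b u) {c T : ℝ} (hT : 0 < T)
    (hn : ∀ t, T ≤ t → c ≤ a t ^ (1 / 3 : ℝ) ∧ 1 ≤ a t ^ (1 / 3 : ℝ))
    (hb : ∀ t, T ≤ t → b t + p ≤ c * (a t ^ (1 / 3 : ℝ)) ^ 2) :
    ∃ C, ∀ t, T ≤ t → |u t ^ 3 - 3 / 2 * a t ^ 2| ≤ C * (a t ^ (1 / 3 : ℝ)) ^ 4 := by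
  set n : ℝ → ℝ := fun t => a t ^ (1 / 3 : ℝ) with hndef
  have hn3 : ∀ t, T ≤ t → n t ^ 3 = a t := fun t ht => by
    have ha := R.a_pos (hT.trans_le ht)
    simp only [hndef]
    rw [← Real.rpow_natCast, ← Real.rpow_mul ha.le]; norm_num
  have hdn : ∀ t, T ≤ t → HasDerivAt (fun t => 9 / 4 * c ^ 2 * n t ^ 4)
      (3 * c ^ 2 * (u t * n t)) t := fun t ht => by
    refine (((R.hasDerivAt_cbrt (hT.trans_le ht)).pow 4).const_mul (9 / 4 * c ^ 2)).congr_deriv ?_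
    change 9 / 4 * c ^ 2 * ((4 : ℕ) * n t ^ (4 - 1) * (u t / (3 * n t ^ 2))) = _
    have : 0 < n t := zero_lt_one.trans_le (hn t ht).2
    push_cast
    field_simp
    ring
  set Q' : ℝ → ℝ := fun t => 3 * u t * ((2 * a t ^ 2 - b t * (b t + p)) / disc p a b t - a t)
  have hdQ : ∀ t, T ≤ t → HasDerivAt (fun t => u t ^ 3 - 3 / 2 * a t ^ 2) (Q' t) t := fun t ht => by
    have ht0 := hT.trans_le ht
    have h1 := R.u_pos t ht0
    have h2 := R.disc_pos ht0
    refine (((R.hasDerivAt_u t ht0).pow 3).sub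
      (((R.hasDerivAt_a t ht0).pow 2).const_mul (3 / 2))).congr_deriv ?_
    simp only [Q']
    push_cast
    field_simp
  have hQ' : ∀ t, T ≤ t → |Q' t| ≤ 3 * c ^ 2 * (u t * n t) := fun t ht => by
    have ht0 := hT.trans_le ht
    have h1 := R.u_pos t ht0
    have h2 := R.b_pos ht0
    have h3 := R.p_pos
    have h4 := (hn t ht).1
    have h5 : 0 < n t := zero_lt_one.trans_le (hn t ht).2
    have hs : b t + p ≤ a t := by
      calc b t + p ≤ c * n t ^ 2 := hb t ht
        _ ≤ n t * n t ^ 2 := by gcongr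
        _ = a t := by rw [← hn3 t ht, pow_succ' (n t) 2]
    have h6 := R.abs_accel_sub_le ht0 hs
    have h7 : (b t + p) ^ 2 / a t ≤ c ^ 2 * n t := by
      rw [div_le_iff₀ (R.a_pos ht0), ← hn3 t ht]
      calc (b t + p) ^ 2 ≤ (c * n t ^ 2) ^ 2 := by gcongr; exact hb t ht
        _ = _ := by ring
    simp only [Q']
    rw [abs_mul, abs_of_pos (by positivity)]
    calc _ ≤ 3 * u t * (c ^ 2 * n t) := by gcongr; exact h6.trans h7
      _ = _ := by ring
  have m1 : MonotoneOn (fun t => 9 / 4 * c ^ 2 * n t ^ 4 + (u t ^ 3 - 3 / 2 * a t ^ 2)) (Ici T) :=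
    monotoneOn_Ici_of_hasDerivAt (fun t ht => (hdn t ht).add (hdQ t ht)) fun t ht => by
      linarith [(abs_le.1 (hQ' t ht)).1]
  have m2 : MonotoneOn (fun t => 9 / 4 * c ^ 2 * n t ^ 4 - (u t ^ 3 - 3 / 2 * a t ^ 2)) (Ici T) :=
    monotoneOn_Ici_of_hasDerivAt (fun t ht => (hdn t ht).sub (hdQ t ht)) fun t ht => by
      linarith [(abs_le.1 (hQ' t ht)).2]
  refine ⟨9 / 4 * c ^ 2 + |u T ^ 3 - 3 / 2 * a T ^ 2|, fun t ht => ?_⟩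
  have k1 := m1 self_mem_Ici (mem_Ici.2 ht) ht
  have k2 := m2 self_mem_Ici (mem_Ici.2 ht) ht
  simp only at k1 k2
  have hnT : 0 ≤ 9 / 4 * c ^ 2 * n T ^ 4 := by positivity
  have h1 : 1 ≤ n t ^ 4 := one_le_pow₀ (hn t ht).2
  have h2 := mul_le_mul_of_nonneg_left h1 (abs_nonneg (u T ^ 3 - 3 / 2 * a T ^ 2))
  change |u t ^ 3 - 3 / 2 * a t ^ 2| ≤ (9 / 4 * c ^ 2 + |u T ^ 3 - 3 / 2 * a T ^ 2|) * n t ^ 4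
  rw [abs_le]
  have h3 := neg_abs_le (u T ^ 3 - 3 / 2 * a T ^ 2)
  have h4 := le_abs_self (u T ^ 3 - 3 / 2 * a T ^ 2)
  constructor <;> linarith

end ReducedFlow

/-- Growth rates of `a`, `b`, `u` along the end, from time `T` on. -/
structure EndGrowth (p : ℝ) (a b u : ℝ → ℝ) (c T : ℝ) : Prop where
  one_le : 1 ≤ T
  c_pos : 0 < c
  le_a : ∀ t, T ≤ t → t ^ 3 / 64 ≤ a t
  a_le : ∀ t, T ≤ t → a t ≤ t ^ 3
  le_u : ∀ t, T ≤ t → t ^ 2 / 16 ≤ u t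
  b_le : ∀ t, T ≤ t → b t + p ≤ c * t ^ 2
  b_le_a : ∀ t, T ≤ t → b t + p ≤ a t
  abs_cube : ∀ t, T ≤ t → |u t ^ 3 / a t ^ 2 - 3 / 2| ≤ c / t ^ 2

theorem ReducedFlow.exists_endGrowth (R : ReducedFlow p a b u)
    (hℓ : IsAsymptoticCircleLength a b ℓ) : ∃ c T, EndGrowth p a b u c T := by
  obtain ⟨c, hc1, hb⟩ := R.eventually_b_le hℓ
  have hnlim : Tendsto (fun t => a t ^ (1 / 3 : ℝ)) atTop atTop :=
    (tendsto_rpow_atTop (by norm_num)).comp R.tendsto_a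
  obtain ⟨T₀, hT₀⟩ := eventually_atTop.1
    ((hb.and (hnlim.eventually_ge_atTop c)).and (eventually_ge_atTop 1))
  have hT₀1 : 1 ≤ T₀ := (hT₀ T₀ le_rfl).2
  obtain ⟨C, hC⟩ := R.exists_abs_cube_sub_le (c := c) (T := T₀) (by linarith)
    (fun t ht => ⟨(hT₀ t ht).1.2, hc1.trans (hT₀ t ht).1.2⟩) fun t ht => (hT₀ t ht).1.1
  set n : ℝ → ℝ := fun t => a t ^ (1 / 3 : ℝ) with hndef
  have hn3 : ∀ t, 0 < t → n t ^ 3 = a t := fun t ht => by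
    have ha := R.a_pos ht
    simp only [hndef]
    rw [← Real.rpow_natCast, ← Real.rpow_mul ha.le]; norm_num
  have hcube : ∀ t, T₀ ≤ t → |u t ^ 3 / a t ^ 2 - 3 / 2| ≤ C / n t ^ 2 := fun t ht => by
    have ht0 : 0 < t := by linarith
    have ha := R.a_pos ht0
    have hn0 : 0 < n t := Real.rpow_pos_of_pos ha _
    have h1 : u t ^ 3 / a t ^ 2 - 3 / 2 = (u t ^ 3 - 3 / 2 * a t ^ 2) / a t ^ 2 := by
      field_simp
    rw [h1, abs_div, abs_of_pos (by positivity : 0 < a t ^ 2), div_le_div_iff₀ (by positivity)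
      (by positivity)]
    calc _ ≤ C * n t ^ 4 * n t ^ 2 := by gcongr; exact hC t ht
      _ = C * (n t ^ 3) ^ 2 := by ring
      _ = _ := by rw [hn3 t ht0]
  have hC0 : 0 ≤ C := by
    have h1 := (abs_nonneg _).trans (hC T₀ le_rfl)
    have hn0 : 0 < n T₀ := Real.rpow_pos_of_pos (R.a_pos (by linarith)) _
    exact nonneg_of_mul_nonneg_left h1 (by positivity)
  -- Once `C / n² ≤ 1/2`, `u / n²` lies in `[1, 2]`, so that `n' = u / (3 n²)` lies in `[1/3, 2/3]`.
  obtain ⟨T₁, hT₁⟩ := eventually_atTop.1 ((hnlim.eventually_ge_atTop (2 * C + 1)).and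
    (eventually_ge_atTop T₀))
  have hT₁0 : T₀ ≤ T₁ := (hT₁ T₁ le_rfl).2
  have hu : ∀ t, T₁ ≤ t → n t ^ 2 ≤ u t ∧ u t ≤ 2 * n t ^ 2 := fun t ht => by
    have ht0 : 0 < t := by linarith
    have ha := R.a_pos ht0
    have hn0 : 0 < n t := Real.rpow_pos_of_pos ha _
    have h1 : 2 * C + 1 ≤ n t := (hT₁ t ht).1
    have h2 : C / n t ^ 2 ≤ 1 / 2 := by
      rw [div_le_div_iff₀ (by positivity) (by norm_num)]
      nlinarith
    have h3 := abs_le.1 ((hcube t (hT₁0.trans ht)).trans h2)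
    have h4 : 1 * a t ^ 2 ≤ u t ^ 3 := by
      rw [← le_div_iff₀ (by positivity)]; linarith
    have h5 : u t ^ 3 ≤ 2 * a t ^ 2 := by
      rw [← div_le_iff₀ (by positivity)]; linarith
    rw [← hn3 t ht0] at h4 h5
    have h6 := R.u_pos t ht0
    have h7 : 0 < n t ^ 6 := by positivity
    constructor
    · exact le_of_pow_le_pow_left₀ (n := 3) (by norm_num) h6.le (by nlinarith)
    · exact le_of_pow_le_pow_left₀ (n := 3) (by norm_num) (by positivity) (by nlinarith)
  have hdn : ∀ t, T₁ ≤ t → HasDerivAt n (u t / (3 * n t ^ 2)) t := fun t ht =>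
    R.hasDerivAt_cbrt (by linarith)
  have hn0 : ∀ t, T₁ ≤ t → 0 < n t := fun t ht => by
    linarith [(hT₁ t ht).1]
  have m1 : MonotoneOn (fun t => n t - 1 / 3 * t) (Ici T₁) := monotoneOn_Ici_of_hasDerivAt
    (fun t ht => (hdn t ht).sub ((hasDerivAt_id t).const_mul (1 / 3))) fun t ht => by
      have := hn0 t ht
      rw [sub_nonneg, mul_one, div_le_div_iff₀ (by norm_num) (by positivity)]
      linarith [(hu t ht).1]
  have m2 : MonotoneOn (fun t => 2 / 3 * t - n t) (Ici T₁) := monotoneOn_Ici_of_hasDerivAt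
    (fun t ht => ((hasDerivAt_id t).const_mul (2 / 3)).sub (hdn t ht)) fun t ht => by
      have := hn0 t ht
      rw [sub_nonneg, mul_one, div_le_div_iff₀ (by positivity) (by norm_num)]
      linarith [(hu t ht).2]
  set T₂ := max T₁ (12 * (|n T₁| + T₁)) with hT₂
  have hT₁1 : 1 ≤ T₁ := hT₀1.trans hT₁0
  have hn : ∀ t, T₂ ≤ t → t / 4 ≤ n t ∧ n t ≤ t := fun t ht => by
    have l1 : T₁ ≤ t := (le_max_left _ _).trans ht
    have l2 : 12 * (|n T₁| + T₁) ≤ t := (le_max_right _ _).trans ht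
    have k1 := m1 self_mem_Ici (mem_Ici.2 l1) l1
    have k2 := m2 self_mem_Ici (mem_Ici.2 l1) l1
    simp only at k1 k2
    have h1 := le_abs_self (n T₁)
    have h2 := hn0 T₁ le_rfl
    constructor <;> linarith
  refine ⟨c + 16 * C, T₂, hT₁1.trans (le_max_left _ _), by linarith, ?_, ?_, ?_, ?_, ?_, ?_⟩ <;>
    intro t ht <;>
    obtain ⟨b1, b2⟩ := hn t ht <;>
    have l1 : T₁ ≤ t := (le_max_left _ _).trans ht <;>
    have ht0 : 0 < t := by linarith
  · rw [← hn3 t ht0]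
    calc t ^ 3 / 64 = (t / 4) ^ 3 := by ring
      _ ≤ _ := by gcongr
  · rw [← hn3 t ht0]
    have := hn0 t l1
    gcongr
  · calc t ^ 2 / 16 = (t / 4) ^ 2 := by ring
      _ ≤ n t ^ 2 := by gcongr
      _ ≤ _ := (hu t l1).1
  · have := hn0 t l1
    refine (hT₀ t (hT₁0.trans l1)).1.1.trans ?_
    change c * n t ^ 2 ≤ _
    gcongr
    linarith
  · have h0 := hn0 t l1
    obtain ⟨⟨h1, h2⟩, -⟩ := hT₀ t (hT₁0.trans l1)
    calc b t + p ≤ c * n t ^ 2 := h1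
      _ ≤ n t * n t ^ 2 := by gcongr
      _ = a t := by rw [← hn3 t ht0, pow_succ' (n t) 2]
  · have h0 := hn0 t l1
    refine (hcube t (hT₁0.trans l1)).trans ?_
    calc C / n t ^ 2 ≤ C / (t / 4) ^ 2 := by gcongr
      _ = 16 * C / t ^ 2 := by field_simp; norm_num
      _ ≤ _ := by gcongr; linarith

end Asymptotic


/-! ### Expansion of the coefficients -/

/-- `X = c + O(1 / t)` as `t → ∞`. -/
def NearConst (X : ℝ → ℝ) (c : ℝ) : Prop := (fun t => X t - c) =O[atTop] fun t : ℝ => t⁻¹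

namespace NearConst

variable {X Y : ℝ → ℝ} {c d : ℝ}

lemma tendsto (hX : NearConst X c) : Tendsto X atTop (𝓝 c) := by
  have h : Tendsto (fun t => X t - c) atTop (𝓝 0) :=
    IsBigO.trans_tendsto hX tendsto_inv_atTop_zero
  simpa using h.add_const c

lemma const (c : ℝ) : NearConst (fun _ => c) c := by
  unfold NearConst
  simp only [sub_self]
  exact isBigO_zero _ _

lemma add (hX : NearConst X c) (hY : NearConst Y d) : NearConst (fun t => X t + Y t) (c + d) :=
  (IsBigO.add hX hY).congr_left fun t => by ring

lemma mul (hX : NearConst X c) (hY : NearConst Y d) : NearConst (fun t => X t * Y t) (c * d) := by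
  have h1 : (fun t => X t * (Y t - d)) =O[atTop] fun t : ℝ => 1 * t⁻¹ :=
    (hX.tendsto.isBigO_one ℝ).mul hY
  have h2 : (fun t => d * (X t - c)) =O[atTop] fun t : ℝ => t⁻¹ := IsBigO.const_mul_left hX d
  simp only [one_mul] at h1
  exact (h1.add h2).congr_left fun t => by ring

lemma inv (hX : NearConst X c) (hc : c ≠ 0) : NearConst (fun t => (X t)⁻¹) c⁻¹ := by
  have h1 : (fun t => (X t)⁻¹ * (X t - c)) =O[atTop] fun t : ℝ => 1 * t⁻¹ :=
    ((hX.tendsto.inv₀ hc).isBigO_one ℝ).mul hX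
  simp only [one_mul] at h1
  refine (h1.const_mul_left (-c⁻¹)).congr' ?_ EventuallyEq.rfl
  filter_upwards [hX.tendsto.eventually_ne hc] with t ht
  field_simp
  ring

end NearConst

section Rates

variable {p ℓ c T : ℝ} {a b u : ℝ → ℝ}

lemma EndGrowth.tendsto_u (E : EndGrowth p a b u c T) : Tendsto u atTop atTop := by
  have h : Tendsto (fun t : ℝ => t ^ 2 / 16) atTop atTop :=
    (tendsto_pow_atTop two_ne_zero).atTop_div_const (by norm_num)
  refine tendsto_atTop_mono' _ ?_ h
  filter_upwards [eventually_ge_atTop T] with t ht using E.le_u t ht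

lemma EndGrowth.nearConst_cube (E : EndGrowth p a b u c T) :
    NearConst (fun t => u t ^ 3 / a t ^ 2) (3 / 2) := by
  refine IsBigO.of_bound c ?_
  filter_upwards [eventually_ge_atTop T] with t ht
  have ht1 : 1 ≤ t := E.one_le.trans ht
  have hc := E.c_pos
  rw [Real.norm_eq_abs, norm_inv, Real.norm_of_nonneg (by linarith), ← div_eq_mul_inv]
  refine (E.abs_cube t ht).trans ?_
  gcongr
  nlinarith

/-- The asymptotic length of the circle fibre is the limit of `A₃ = (b - p) / u`. -/
lemma EndGrowth.tendsto_ratio (R : ReducedFlow p a b u) (E : EndGrowth p a b u c T)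
    (hℓ : IsAsymptoticCircleLength a b ℓ) :
    Tendsto (fun t => (b t - p) / u t) atTop (𝓝 ℓ) := by
  have hℓ0 : 0 ≤ ℓ := by
    refine ge_of_tendsto hℓ ?_
    filter_upwards [eventually_gt_atTop 0] with t ht
    have := R.b_pos ht
    positivity
  have h1 : Tendsto (fun t => 2 * b t ^ 3 / (3 * a t ^ 2)) atTop (𝓝 (ℓ ^ 3)) := by
    refine (hℓ.pow 3).congr' ?_
    filter_upwards [eventually_gt_atTop 0] with t ht
    have := R.b_pos ht
    rw [← Real.rpow_natCast, ← Real.rpow_mul (by positivity)]; norm_num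
  have h2 := (h1.mul_const (3 / 2)).div E.nearConst_cube.tendsto (by norm_num)
  have h3 : Tendsto (fun t => (b t / u t) ^ 3) atTop (𝓝 (ℓ ^ 3)) := by
    rw [mul_div_cancel_right₀ _ (by norm_num)] at h2
    refine h2.congr' ?_
    filter_upwards [eventually_gt_atTop 0] with t ht
    have h4 := R.a_pos ht
    have h5 := R.u_pos t ht
    simp only [Pi.div_apply]
    field_simp
  have hroot : ∀ x : ℝ, 0 ≤ x → (x ^ 3) ^ (1 / 3 : ℝ) = x := fun x hx => by
    rw [← Real.rpow_natCast, ← Real.rpow_mul hx]; norm_num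
  have h4 : Tendsto (fun t => b t / u t) atTop (𝓝 ℓ) := by
    have := h3.rpow_const (p := (1 / 3 : ℝ)) (Or.inr (by norm_num))
    rw [hroot ℓ hℓ0] at this
    refine this.congr' ?_
    filter_upwards [eventually_gt_atTop 0] with t ht
    have h4 := R.b_pos ht
    have h5 := R.u_pos t ht
    exact hroot _ (by positivity)
  have h5 := h4.sub (E.tendsto_u.const_div_atTop p)
  rw [sub_zero] at h5
  exact h5.congr fun t => (sub_div _ _ _).symm

lemma ReducedFlow.monotoneOn_ratio (R : ReducedFlow p a b u) {T : ℝ} (hT : 0 < T) :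
    MonotoneOn (fun t => (b t - p) / u t) (Ici T) :=
  monotoneOn_Ici_of_hasDerivAt (fun t ht => R.hasDerivAt_ratio (hT.trans_le ht)) fun t ht => by
    have ht0 := hT.trans_le ht
    have h1 := R.u_pos t ht0
    have h2 := R.disc_pos ht0
    have h3 := R.b_pos ht0
    have h4 := R.p_pos
    positivity

lemma ReducedFlow.ratio_pos (R : ReducedFlow p a b u) {t : ℝ} (ht : 0 < t) :
    0 < (b t - p) / u t := div_pos (sub_pos.2 (R.p_lt_b t ht)) (R.u_pos t ht)

lemma EndGrowth.ratio_le (R : ReducedFlow p a b u) (E : EndGrowth p a b u c T)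
    (hℓ : IsAsymptoticCircleLength a b ℓ) {t : ℝ} (ht : 0 < t) : (b t - p) / u t ≤ ℓ := by
  refine ge_of_tendsto (E.tendsto_ratio R hℓ) ?_
  filter_upwards [eventually_ge_atTop t] with s hs
  exact R.monotoneOn_ratio ht self_mem_Ici hs hs

lemma EndGrowth.circleLength_pos (R : ReducedFlow p a b u) (E : EndGrowth p a b u c T)
    (hℓ : IsAsymptoticCircleLength a b ℓ) : 0 < ℓ :=
  (R.ratio_pos one_pos).trans_le (E.ratio_le R hℓ one_pos)

lemma hasDerivAt_const_div_sq (C : ℝ) {t : ℝ} (ht : t ≠ 0) :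
    HasDerivAt (fun t : ℝ => C / t ^ 2) (-(2 * C / t ^ 3)) t := by
  refine ((hasDerivAt_const t C).div (hasDerivAt_pow 2 t) (pow_ne_zero 2 ht)).congr_deriv ?_
  push_cast
  field_simp
  ring

lemma hasDerivAt_const_div (C : ℝ) {t : ℝ} (ht : t ≠ 0) :
    HasDerivAt (fun t : ℝ => C / t) (-(C / t ^ 2)) t := by
  refine ((hasDerivAt_const t C).div (hasDerivAt_id t) ht).congr_deriv ?_
  simp [neg_div]

lemma EndGrowth.le_disc (R : ReducedFlow p a b u) (E : EndGrowth p a b u c T) {t : ℝ}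
    (ht : T ≤ t) : t ^ 3 / 64 ≤ disc p a b t :=
  (E.le_a t ht).trans (R.le_disc (zero_lt_one.trans_le (E.one_le.trans ht)) (E.b_le_a t ht))

lemma EndGrowth.le_ratio (R : ReducedFlow p a b u) (E : EndGrowth p a b u c T)
    (hℓ : IsAsymptoticCircleLength a b ℓ) {t : ℝ} (ht : T ≤ t) :
    ℓ ≤ (b t - p) / u t + 65536 * c ^ 3 / t ^ 2 := by
  have hT0 : 0 < T := zero_lt_one.trans_le E.one_le
  have hmono : MonotoneOn (fun t => -((b t - p) / u t + 65536 * c ^ 3 / t ^ 2)) (Ici T) := by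
    refine monotoneOn_Ici_of_hasDerivAt (fun t ht =>
      ((R.hasDerivAt_ratio (hT0.trans_le ht)).add
        (hasDerivAt_const_div_sq (65536 * c ^ 3) (hT0.trans_le ht).ne')).neg) fun t ht => ?_
    have ht0 := hT0.trans_le ht
    have h1 := E.le_disc R ht
    have h2 := E.le_u t ht
    have h3 := E.b_le t ht
    have h4 := R.p_lt_b t ht0
    have h5 := R.p_pos
    have h6 : b t - p ≤ c * t ^ 2 := by linarith
    have h7 := E.c_pos
    have hu := R.u_pos t ht0
    have h8 : (b t - p) ^ 2 * (b t + p) / (2 * u t ^ 3 * disc p a b t) ≤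
        (c * t ^ 2) ^ 2 * (c * t ^ 2) / (2 * (t ^ 2 / 16) ^ 3 * (t ^ 3 / 64)) := by
      gcongr
      linarith
    have h9 : (c * t ^ 2) ^ 2 * (c * t ^ 2) / (2 * (t ^ 2 / 16) ^ 3 * (t ^ 3 / 64)) =
        2 * (65536 * c ^ 3) / t ^ 3 := by
      field_simp
      norm_num
    linarith
  have hlim : Tendsto (fun t => -((b t - p) / u t + 65536 * c ^ 3 / t ^ 2)) atTop (𝓝 (-ℓ)) := by
    have := ((E.tendsto_ratio R hℓ).add
      ((tendsto_pow_atTop two_ne_zero).const_div_atTop (65536 * c ^ 3))).neg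
    simpa using this
  have h : -((b t - p) / u t + 65536 * c ^ 3 / t ^ 2) ≤ -ℓ := by
    refine ge_of_tendsto hlim ?_
    filter_upwards [eventually_ge_atTop t] with s hs
    exact hmono ht (mem_Ici.2 (le_trans ht hs)) hs
  linarith

/-- `a / u` is asymptotic to `t / 3` up to a bounded error. -/
lemma EndGrowth.exists_abs_div_sub_le (R : ReducedFlow p a b u) (E : EndGrowth p a b u c T) :
    ∃ C, ∀ t, T ≤ t → |a t / u t - t / 3| ≤ C := by
  have hT0 : 0 < T := zero_lt_one.trans_le E.one_le
  have hc := E.c_pos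
  set C₁ := 4096 * (c + c ^ 2) with hC₁
  set z' : ℝ → ℝ := fun t => 1 - a t * ((2 * a t ^ 2 - b t * (b t + p)) / disc p a b t) / u t ^ 3
  have hdz : ∀ t, T ≤ t → HasDerivAt (fun t => a t / u t - t / 3) (z' t - 1 / 3) t :=
    fun t ht => by
      have ht0 := hT0.trans_le ht
      have h1 := R.u_pos t ht0
      have h2 := R.disc_pos ht0
      refine (((R.hasDerivAt_a t ht0).div (R.hasDerivAt_u t ht0) h1.ne').sub
        ((hasDerivAt_id t).div_const 3)).congr_deriv ?_
      simp only [z']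
      field_simp
  have hz' : ∀ t, T ≤ t → |z' t - 1 / 3| ≤ C₁ / t ^ 2 := fun t ht => by
    have ht0 := hT0.trans_le ht
    have h1 := R.u_pos t ht0
    have h2 := R.a_pos ht0
    have h3 := R.b_pos ht0
    have h4 := R.p_pos
    have h5 := E.le_u t ht
    have h6 := E.b_le t ht
    have h7 := R.abs_accel_sub_le ht0 (E.b_le_a t ht)
    have h8 := E.a_le t ht
    have h9 := E.abs_cube t ht
    set e := (2 * a t ^ 2 - b t * (b t + p)) / disc p a b t - a t with he
    have hu3 : t ^ 6 / 4096 ≤ u t ^ 3 := by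
      calc t ^ 6 / 4096 = (t ^ 2 / 16) ^ 3 := by ring
        _ ≤ _ := by gcongr
    have k1 : |a t * e / u t ^ 3| ≤ 4096 * c ^ 2 / t ^ 2 := by
      rw [abs_div, abs_mul, abs_of_pos h2, abs_of_pos (by positivity : 0 < u t ^ 3)]
      calc a t * |e| / u t ^ 3 ≤ a t * ((b t + p) ^ 2 / a t) / u t ^ 3 := by gcongr
        _ = (b t + p) ^ 2 / u t ^ 3 := by field_simp
        _ ≤ (c * t ^ 2) ^ 2 / (t ^ 6 / 4096) := by gcongr
        _ = _ := by field_simp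
    have k2 : |2 / 3 - a t ^ 2 / u t ^ 3| ≤ 4096 * c / t ^ 2 := by
      have e1 : 2 / 3 - a t ^ 2 / u t ^ 3 =
          2 / 3 * (u t ^ 3 / a t ^ 2 - 3 / 2) * (a t ^ 2 / u t ^ 3) := by
        field_simp
      rw [e1, abs_mul, abs_mul, abs_of_pos (by positivity : 0 < a t ^ 2 / u t ^ 3),
        abs_of_pos (by norm_num : (0 : ℝ) < 2 / 3)]
      calc _ ≤ 2 / 3 * (c / t ^ 2) * ((t ^ 3) ^ 2 / (t ^ 6 / 4096)) := by gcongr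
        _ = 2 / 3 * 4096 * c / t ^ 2 := by field_simp
        _ ≤ _ := by gcongr; norm_num
    have e2 : z' t - 1 / 3 = (2 / 3 - a t ^ 2 / u t ^ 3) - a t * e / u t ^ 3 := by
      simp only [z', he]
      ring
    rw [e2]
    refine (abs_sub _ _).trans ((add_le_add k2 k1).trans_eq ?_)
    rw [hC₁]; ring
  have m1 : MonotoneOn (fun t => a t / u t - t / 3 - C₁ / t) (Ici T) :=
    monotoneOn_Ici_of_hasDerivAt (fun t ht =>
      (hdz t ht).sub (hasDerivAt_const_div C₁ (hT0.trans_le ht).ne')) fun t ht => by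
        linarith [(abs_le.1 (hz' t ht)).1]
  have m2 : MonotoneOn (fun t => -(a t / u t - t / 3) - C₁ / t) (Ici T) :=
    monotoneOn_Ici_of_hasDerivAt (fun t ht =>
      (hdz t ht).neg.sub (hasDerivAt_const_div C₁ (hT0.trans_le ht).ne')) fun t ht => by
        linarith [(abs_le.1 (hz' t ht)).2]
  refine ⟨|a T / u T - T / 3| + C₁ / T, fun t ht => ?_⟩
  have k1 := m1 self_mem_Ici (mem_Ici.2 ht) ht
  have k2 := m2 self_mem_Ici (mem_Ici.2 ht) ht
  simp only at k1 k2
  have ht0 := hT0.trans_le ht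
  have h0 : 0 ≤ C₁ / t := by positivity
  have h1 : C₁ / t ≤ C₁ / T := by gcongr
  have h3 := neg_abs_le (a T / u T - T / 3)
  have h4 := le_abs_self (a T / u T - T / 3)
  rw [abs_le]
  constructor <;> linarith

lemma EndGrowth.nearConst_mul_div (R : ReducedFlow p a b u) (E : EndGrowth p a b u c T) :
    NearConst (fun t => t * u t / a t) 3 := by
  obtain ⟨C, hC⟩ := E.exists_abs_div_sub_le R
  have h : NearConst (fun t => a t / u t / t) (1 / 3) := by
    refine IsBigO.of_bound C ?_
    filter_upwards [eventually_ge_atTop T] with t ht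
    have ht0 : 0 < t := zero_lt_one.trans_le (E.one_le.trans ht)
    have e : a t / u t / t - 1 / 3 = (a t / u t - t / 3) / t := by field_simp
    rw [e, norm_div, norm_inv, Real.norm_eq_abs, Real.norm_of_nonneg ht0.le, div_eq_mul_inv]
    gcongr
    exact hC t ht
  have h2 := h.inv (by norm_num)
  rw [one_div, inv_inv] at h2
  refine IsBigO.congr_left h2 fun t => ?_
  simp only [inv_div, div_div_eq_mul_div]

lemma EndGrowth.nearConst_disc (R : ReducedFlow p a b u) (E : EndGrowth p a b u c T) :
    NearConst (fun t => disc p a b t / (2 * a t)) 1 := by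
  refine IsBigO.of_bound (1024 * c ^ 2) ?_
  filter_upwards [eventually_ge_atTop T] with t ht
  have ht1 : 1 ≤ t := E.one_le.trans ht
  have ht0 : 0 < t := by linarith
  have h1 := R.disc_sq ht0
  have h2 := R.disc_pos ht0
  have h3 := R.a_pos ht0
  have h4 := R.disc_le ht0
  have h5 := R.b_pos ht0
  have h6 := R.p_pos
  have h7 := E.b_le t ht
  have h8 := E.le_a t ht
  have hc := E.c_pos
  have hq : (b t + p) / (2 * a t) ≤ 32 * c / t := by
    calc (b t + p) / (2 * a t) ≤ c * t ^ 2 / (2 * (t ^ 3 / 64)) := by gcongr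
      _ = _ := by field_simp; norm_num
  have hle : disc p a b t / (2 * a t) ≤ 1 := by
    rw [div_le_one (by positivity)]; exact h4
  have hpos : 0 < disc p a b t / (2 * a t) := by positivity
  have hsq : (disc p a b t / (2 * a t)) ^ 2 = 1 - ((b t + p) / (2 * a t)) ^ 2 := by
    rw [div_pow, h1]
    field_simp
    ring
  have hq2 : ((b t + p) / (2 * a t)) ^ 2 ≤ (32 * c / t) ^ 2 := by gcongr
  rw [Real.norm_eq_abs, abs_sub_comm, abs_of_nonneg (by linarith), norm_inv,
    Real.norm_of_nonneg ht0.le, ← div_eq_mul_inv]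
  calc 1 - disc p a b t / (2 * a t) ≤ (32 * c / t) ^ 2 := by nlinarith
    _ = 1024 * c ^ 2 / t ^ 2 := by ring
    _ ≤ _ := by gcongr; nlinarith

/-- On the end the coefficient of `f` is `-ℓ⁻¹ + 5 / (2 t) + O(t⁻²)`: the first two terms contribute
`3 / (2 t)` and `1 / t`, and the last one is `-1 / A₃`. -/
theorem EndGrowth.fCoeff_isBigO (R : ReducedFlow p a b u) (E : EndGrowth p a b u c T)
    (hℓ : IsAsymptoticCircleLength a b ℓ) :
    (fun t => fCoeff p a b u t + ℓ⁻¹ - 5 / (2 * t)) =O[atTop] fun t => 1 / t ^ 2 := by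
  have hℓ0 := E.circleLength_pos R hℓ
  have hc := E.c_pos
  have n1 := E.nearConst_disc R
  have n2 := E.nearConst_cube
  have n3 := E.nearConst_mul_div R
  have n1' := n1.inv one_ne_zero
  have n2' := n2.inv (by norm_num)
  have hmain : (fun t => 2 * a t * u t / disc p a b t ^ 2 + disc p a b t / (4 * u t ^ 2) -
      5 / (2 * t)) =O[atTop] fun t => 1 / t ^ 2 := by
    have h1 := (((NearConst.const (1 / 2)).mul n3).mul (n1'.mul n1')).add
      ((((NearConst.const (1 / 2)).mul n1).mul n3).mul n2')
    have h2 := IsBigO.mul h1 (isBigO_refl (fun t : ℝ => t⁻¹) atTop)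
    refine (h2.congr' ?_ ?_)
    · filter_upwards [eventually_gt_atTop 0] with t ht0
      have k1 := R.disc_pos ht0
      have k2 := R.a_pos ht0
      have k3 := R.u_pos t ht0
      field_simp
      ring
    · filter_upwards [eventually_gt_atTop 0] with t ht0
      field_simp
  have hthird : (fun t => (b t - p) * disc p a b t / (4 * u t ^ 2 * (2 * a t - (b t + p))))
      =O[atTop] fun t => 1 / t ^ 2 := by
    refine IsBigO.of_bound (8 * ℓ) ?_
    filter_upwards [eventually_ge_atTop T] with t ht
    have ht0 : 0 < t := zero_lt_one.trans_le (E.one_le.trans ht)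
    have k1 := R.disc_pos ht0
    have k2 := R.a_pos ht0
    have k3 := R.u_pos t ht0
    have k4 := E.ratio_le R hℓ ht0
    have k5 := R.ratio_pos ht0
    have k6 := E.le_u t ht
    have k7 : a t ≤ 2 * a t - (b t + p) := by linarith [E.b_le_a t ht]
    have k8 : 0 < 2 * a t - (b t + p) := by linarith
    have e : (b t - p) * disc p a b t / (4 * u t ^ 2 * (2 * a t - (b t + p))) =
        (b t - p) / u t * (disc p a b t / (2 * a t - (b t + p))) / (4 * u t) := by
      field_simp
    have k9 : disc p a b t / (2 * a t - (b t + p)) ≤ 2 := by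
      rw [div_le_iff₀ k8]
      linarith [R.disc_le ht0]
    rw [e, Real.norm_of_nonneg (by positivity), Real.norm_of_nonneg (by positivity)]
    calc _ ≤ ℓ * 2 / (4 * (t ^ 2 / 16)) := by gcongr
      _ = _ := by field_simp; norm_num
  have hfourth : (fun t => u t / (b t - p) - ℓ⁻¹) =O[atTop] fun t => 1 / t ^ 2 := by
    set k₁ := (b 1 - p) / u 1 with hk₁
    have hk₁0 : 0 < k₁ := R.ratio_pos one_pos
    refine IsBigO.of_bound (65536 * c ^ 3 / (k₁ * ℓ)) ?_
    filter_upwards [eventually_ge_atTop T] with t ht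
    have ht1 : 1 ≤ t := E.one_le.trans ht
    have ht0 : 0 < t := by linarith
    have j1 := R.ratio_pos ht0
    have j2 := E.ratio_le R hℓ ht0
    have j3 := E.le_ratio R hℓ ht
    have j4 : k₁ ≤ (b t - p) / u t :=
      R.monotoneOn_ratio one_pos self_mem_Ici (mem_Ici.2 ht1) ht1
    have e : u t / (b t - p) - ℓ⁻¹ =
        (ℓ - (b t - p) / u t) / ((b t - p) / u t * ℓ) := by
      have j5 := R.u_pos t ht0
      have j6 := sub_pos.2 (R.p_lt_b t ht0)
      field_simp
    have j7 : 0 ≤ ℓ - (b t - p) / u t := by linarith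
    rw [e, Real.norm_of_nonneg (by positivity), Real.norm_of_nonneg (by positivity)]
    calc _ ≤ 65536 * c ^ 3 / t ^ 2 / (k₁ * ℓ) := by
          gcongr
          linarith
      _ = _ := by ring
  refine ((hmain.sub hthird).sub hfourth).congr_left fun t => ?_
  simp only [fCoeff]
  ring

lemma EndGrowth.gCoeff_isBigO (R : ReducedFlow p a b u) (E : EndGrowth p a b u c T) :
    (fun t => gCoeff p a b u t) =O[atTop] fun t => 1 / t ^ 3 := by
  refine IsBigO.of_bound (8192 * c ^ 2) ?_
  filter_upwards [eventually_ge_atTop T] with t ht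
  have ht0 : 0 < t := zero_lt_one.trans_le (E.one_le.trans ht)
  have h1 := R.p_lt_b t ht0
  have h2 := R.p_pos
  have h3 := E.b_le t ht
  have h4 := E.le_u t ht
  have h5 := E.le_disc R ht
  have h6 : 0 ≤ b t - p := by linarith
  have h7 : 0 ≤ b t + p := by linarith
  have h8 := R.disc_pos ht0
  have h9 := R.u_pos t ht0
  have h10 := E.c_pos
  rw [gCoeff, norm_neg, Real.norm_of_nonneg (by positivity), Real.norm_of_nonneg (by positivity)]
  calc _ ≤ c * t ^ 2 * (c * t ^ 2) / (2 * (t ^ 2 / 16) ^ 2 * (t ^ 3 / 64)) := by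
        gcongr
        linarith
    _ = _ := by field_simp; norm_num

lemma ReducedFlow.contDiffOn_coeffs (R : ReducedFlow p a b u) (ha : ContDiffOn ℝ ∞ a (Ioi 0))
    (hb : ContDiffOn ℝ ∞ b (Ioi 0)) (hu : ContDiffOn ℝ ∞ u (Ioi 0)) :
    ContDiffOn ℝ ∞ (fCoeff p a b u) (Ioi 0) ∧ ContDiffOn ℝ ∞ (gCoeff p a b u) (Ioi 0) := by
  have hD : ContDiffOn ℝ ∞ (disc p a b) (Ioi 0) :=
    ((contDiffOn_const.mul (ha.pow 2)).sub ((hb.add contDiffOn_const).pow 2)).sqrt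
      fun t ht => (R.radicand_pos ht).ne'
  have hu0 : ∀ t ∈ Ioi (0 : ℝ), u t ≠ 0 := fun t ht => (R.u_pos t ht).ne'
  have hD0 : ∀ t ∈ Ioi (0 : ℝ), disc p a b t ≠ 0 := fun t ht => (R.disc_pos ht).ne'
  have hβ : ContDiffOn ℝ ∞ (fun t => b t - p) (Ioi 0) := hb.sub contDiffOn_const
  have hs : ContDiffOn ℝ ∞ (fun t => b t + p) (Ioi 0) := hb.add contDiffOn_const
  have hβ0 : ∀ t ∈ Ioi (0 : ℝ), b t - p ≠ 0 := fun t ht => (sub_pos.2 (R.p_lt_b t ht)).ne'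
  have hA0 : ∀ t ∈ Ioi (0 : ℝ), 2 * a t - (b t + p) ≠ 0 := fun t ht =>
    (sub_pos.2 (R.add_lt_two_mul ht)).ne'
  have h2a : ContDiffOn ℝ ∞ (fun t => 2 * a t) (Ioi 0) := contDiffOn_const.mul ha
  have h4u : ContDiffOn ℝ ∞ (fun t => 4 * u t ^ 2) (Ioi 0) := contDiffOn_const.mul (hu.pow 2)
  have h2u : ContDiffOn ℝ ∞ (fun t => 2 * u t ^ 2) (Ioi 0) := contDiffOn_const.mul (hu.pow 2)
  have h4u0 : ∀ t ∈ Ioi (0 : ℝ), 4 * u t ^ 2 ≠ 0 := fun t ht =>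
    mul_ne_zero four_ne_zero (pow_ne_zero 2 (hu0 t ht))
  have h2u0 : ∀ t ∈ Ioi (0 : ℝ), 2 * u t ^ 2 ≠ 0 := fun t ht =>
    mul_ne_zero two_ne_zero (pow_ne_zero 2 (hu0 t ht))
  constructor
  · exact ((((h2a.mul hu).div (hD.pow 2) fun t ht => pow_ne_zero 2 (hD0 t ht)).add
      (hD.div h4u h4u0)).sub ((hβ.mul hD).div (h4u.mul (h2a.sub hs))
        fun t ht => mul_ne_zero (h4u0 t ht) (hA0 t ht))).sub (hu.div hβ hβ0)
  · exact ((hβ.mul hs).div (h2u.mul hD) fun t ht => mul_ne_zero (h2u0 t ht) (hD0 t ht)).neg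

lemma EndGrowth.exists_endCoeffs (R : ReducedFlow p a b u) (E : EndGrowth p a b u c T)
    (hℓ : IsAsymptoticCircleLength a b ℓ) (hf : ContinuousOn (fCoeff p a b u) (Ioi 0))
    (hg : ContinuousOn (gCoeff p a b u) (Ioi 0)) :
    ∃ C T₀, EndCoeffs (fun t => fCoeff p a b u t + ℓ⁻¹ - 5 / (2 * t)) (gCoeff p a b u) C T₀ := by
  obtain ⟨C₁, h₁⟩ := (E.fCoeff_isBigO R hℓ).bound
  obtain ⟨C₂, h₂⟩ := (E.gCoeff_isBigO R).bound
  obtain ⟨T₀, hT₀⟩ := eventually_atTop.1 ((h₁.and h₂).and (eventually_ge_atTop 1))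
  refine ⟨max 0 (max C₁ C₂), T₀, (hT₀ T₀ le_rfl).2, le_max_left _ _, ?_, hg, fun s hs => ?_,
    fun s hs => ?_⟩
  · refine (hf.add continuousOn_const).sub (continuousOn_const.div (by fun_prop) fun t ht => ?_)
    exact mul_ne_zero two_ne_zero (ne_of_gt ht)
  · obtain ⟨⟨k, -⟩, k1⟩ := hT₀ s hs
    have hs0 : 0 < s := by linarith
    rw [Real.norm_of_nonneg (by positivity : 0 ≤ 1 / s ^ 2), mul_one_div] at k
    refine k.trans ?_
    gcongr
    exact (le_max_left _ _).trans (le_max_right _ _)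
  · obtain ⟨⟨-, k⟩, k1⟩ := hT₀ s hs
    have hs0 : 0 < s := by linarith
    rw [Real.norm_of_nonneg (by positivity : 0 ≤ 1 / s ^ 3), mul_one_div] at k
    refine k.trans ?_
    gcongr
    exact (le_max_right _ _).trans (le_max_right _ _)

end Rates

/-! ### The reduced instanton equations -/

section Reduced

variable {p : ℝ} {a b : ℝ → ℝ}

/-- In terms of `a`, `b` and `a'`, the reduced instanton equations are the system with coefficients
`fCoeff` and `gCoeff`. -/
lemma ReducedFlow.reducedODEAt_iff (R : ReducedFlow p a b (deriv a)) {f g : ℝ → ℝ} {t : ℝ}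
    (ht : 0 < t) :
    ReducedODEAt (coeffA₁ p a b) (coeffB₁ p a b) (coeffA₃ p a b) (coeffB₃ p a b) f g t ↔
      HasDerivAt f (-((fCoeff p a b (deriv a) t + g t) * f t)) t ∧
        HasDerivAt g (-(gCoeff p a b (deriv a) t * g t + f t ^ 2)) t := by
  have hu := R.u_pos t ht
  have hD := R.disc_pos ht
  have hD2 := R.disc_sq ht
  have hβ := sub_pos.2 (R.p_lt_b t ht)
  have hb' := (R.hasDerivAt_b t ht).deriv
  have hA := sub_pos.2 (R.add_lt_two_mul ht)
  have hb := R.b_pos ht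
  have ha := R.a_pos ht
  have hp := R.p_pos
  have hbpos : 0 < deriv b t := by rw [hb']; positivity
  set D := disc p a b t with hDdef
  have e1 : coeffA₁ p a b t ^ 2 =
      (b t - p) * (2 * a t - b t - p) / (deriv a t * deriv b t) := by
    have : 0 < 2 * a t - b t - p := by linarith
    exact Real.sq_sqrt (by positivity)
  have e2 : coeffB₁ p a b t ^ 2 =
      (b t - p) * (2 * a t + b t + p) / (deriv a t * deriv b t) :=
    Real.sq_sqrt (by positivity)
  have e3 : coeffA₁ p a b t * coeffB₁ p a b t = (b t - p) * D / (deriv a t * deriv b t) := by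
    have : 0 < 2 * a t - b t - p := by linarith
    rw [coeffA₁, coeffB₁, ← Real.sqrt_mul (by positivity), Real.sqrt_eq_iff_mul_self_eq_of_pos
      (by positivity)]
    rw [div_mul_div_comm, div_mul_div_comm]
    congr 1
    linear_combination (b t - p) ^ 2 * hD2
  have hD2' : (2 * a t - (b t + p)) * (2 * a t + b t + p) = D ^ 2 := by rw [hD2]; ring
  have hA' : 0 < 2 * a t + b t + p := by positivity
  have kf : 1 / 2 * ((coeffA₁ p a b t ^ 2 + coeffB₃ p a b t ^ 2 + coeffB₁ p a b t ^ 2) /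
      (coeffA₁ p a b t * coeffB₁ p a b t * coeffB₃ p a b t) -
      (coeffA₃ p a b t ^ 2 + 2 * coeffA₁ p a b t ^ 2) / (coeffA₁ p a b t ^ 2 * coeffA₃ p a b t)) =
      fCoeff p a b (deriv a) t := by
    rw [e1, e2, e3, coeffA₃, coeffB₃, fCoeff, ← hDdef, hb',
      show 2 * a t - b t - p = 2 * a t - (b t + p) by ring]
    field_simp
    ring
  have kg : 1 / 2 * (coeffA₃ p a b t / coeffB₁ p a b t ^ 2 -
      coeffA₃ p a b t / coeffA₁ p a b t ^ 2) = gCoeff p a b (deriv a) t := by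
    rw [e1, e2, coeffA₃, gCoeff, ← hDdef, hb',
      show 2 * a t - b t - p = 2 * a t - (b t + p) by ring]
    have : (b t - p) * (b t + p) / (2 * deriv a t ^ 2 * D) =
        (b t - p) * (b t + p) * D / (2 * deriv a t ^ 2 *
          ((2 * a t - (b t + p)) * (2 * a t + b t + p))) := by
      rw [hD2']
      field_simp
    rw [this]
    field_simp
    ring
  unfold ReducedODEAt
  rw [kf, kg]
  constructor
  · rintro ⟨df, dg, hf, hg⟩
    exact ⟨df.hasDerivAt.congr_deriv (by linarith), dg.hasDerivAt.congr_deriv (by linarith)⟩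
  · rintro ⟨hf, hg⟩
    refine ⟨hf.differentiableAt, hg.differentiableAt, ?_, ?_⟩
    · rw [hf.deriv]; ring
    · rw [hg.deriv]; ring

lemma ReducedFlow.solvesOn_of_isReducedSolution (R : ReducedFlow p a b (deriv a)) {f g : ℝ → ℝ}
    {T T' : ℝ} (hT : 0 ≤ T) (hTT : T' ≤ T) (h : IsReducedSolution p a b T' f g) :
    SolvesOn (fCoeff p a b (deriv a)) (gCoeff p a b (deriv a)) T f g :=
  fun t ht => (R.reducedODEAt_iff (hT.trans_lt ht)).1 (h t (hTT.trans_lt ht))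

end Reduced

end G2End

theorem mainTheorem4 (r₀ abar bbar : ℝ) (a b : ℝ → ℝ) (hab : G2End.IsB7Member r₀ abar bbar a b)
    (ℓ : ℝ) (hℓ : G2End.IsAsymptoticCircleLength a b ℓ) :
    0 < ℓ ∧
    ∃ (T : ℝ × ℝ → ℝ) (f g : ℝ × ℝ → ℝ → ℝ),
      (∀ P ∈ G2End.endParameters ℓ,
        0 < T P ∧
        ContDiffOn ℝ ∞ (f P) (Ioi (T P)) ∧ ContDiffOn ℝ ∞ (g P) (Ioi (T P)) ∧
        G2End.IsReducedSolution (r₀ ^ 3) a b (T P) (f P) (g P) ∧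
        G2End.HasEndBehaviour ℓ P.1 P.2 (f P) (g P) ∧
        (∀ (T' : ℝ) (f' g' : ℝ → ℝ),
          G2End.IsReducedSolution (r₀ ^ 3) a b T' f' g' →
          G2End.HasEndBehaviour ℓ P.1 P.2 f' g' →
          ∀ t, max (T P) T' < t → f' t = f P t ∧ g' t = g P t)) ∧
      (∀ P₀ ∈ G2End.endParameters ℓ, ∀ t₁ t₂ : ℝ, T P₀ < t₁ → t₁ ≤ t₂ →
        (∀ᶠ P in 𝓝[G2End.endParameters ℓ] P₀, T P < t₁) ∧
        TendstoUniformlyOn f (f P₀) (𝓝[G2End.endParameters ℓ] P₀) (Icc t₁ t₂) ∧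
        TendstoUniformlyOn g (g P₀) (𝓝[G2End.endParameters ℓ] P₀) (Icc t₁ t₂)) := by
  have R := hab.reducedFlow
  obtain ⟨c, T₁, E⟩ := R.exists_endGrowth hℓ
  obtain ⟨hf, hg⟩ := R.contDiffOn_coeffs (hab.contDiffOn_a.mono Ioi_subset_Ici_self)
    (hab.contDiffOn_b.mono Ioi_subset_Ici_self) (G2End.contDiffOn_deriv_Ioi hab.contDiffOn_a)
  obtain ⟨C, T₀, hc⟩ := E.exists_endCoeffs R hℓ hf.continuousOn hg.continuousOn
  obtain ⟨T, f, g, hsol, hcont⟩ := G2End.exists_end_solutions hf hg hc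
  refine ⟨E.circleLength_pos R hℓ, T, f, g, fun P hP => ?_, hcont⟩
  obtain ⟨hT, cf, cg, hs, he, huniq⟩ := hsol P hP
  refine ⟨hT, cf, cg, fun t ht => (R.reducedODEAt_iff (hT.trans ht)).2 (hs t ht), he,
    fun T' f' g' hs' he' t ht => ?_⟩
  -- `T'` may be negative, where the metric coefficients carry no information.
  refine huniq (max T' 0) f' g'
    (R.solvesOn_of_isReducedSolution (le_max_right _ _) (le_max_left _ _) hs') he' t ?_
  simp only [max_lt_iff] at ht ⊢
  exact ⟨ht.1, ht.2, hT.trans ht.1⟩
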